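/- Let $\sigma_0=I$ and let $\sigma_1,\sigma_2,\sigma_3$ be the Pauli matrices. For $\boldsymbol a\in\mathbb R^3$ and a real $3\times3$ matrix $T$ put $$\rho(\boldsymbol a,T)=\tfrac14\Big(I\otimes I+\boldsymbol a\cdot\boldsymbol\sigma\otimes I+\sum_{i,j=1}^3T_{ij}\,\sigma_i\otimes\sigma_j\Big),$$ where the first tensor factor is Alice's qubit and the second is Bob's. A two-qubit state $\rho$ is called non-steerable (from Alice to Bob, by projective measurements) if there are a probability measure $\mu$ and qubit states $\sigma_\lambda$ such that for every projective measurement $\{\Pi_i\}_i$ of Alice there are response functions $p(i|\lambda)\ge0$ with $\sum_ip(i|\lambda)=1$ and $$\operatorname{Tr}_A[(\Pi_i\otimes I)\rho]=\int p(i|\lambda)\,\sigma_\lambda\,d\mu(\lambda)\quad\text{for all } i.$$ For $u,v\in\mathbb R$ let $\Phi_{u,v}$ be the linear map on $\mathbb C^{2\times2}$ with $\Phi_{u,v}(I)=I+\sin u\sin v\,\sigma_3$, $\Phi_{u,v}(\sigma_1)=\cos u\,\sigma_1$, $\Phi_{u,v}(\sigma_2)=\cos v\,\sigma_2$, $\Phi_{u,v}(\sigma_3)=\cos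 u\cos v\,\sigma_3$. For a real diagonal matrix $T$ put $$\mathcal I(T)=\frac1{2\pi}\iint_{S^2}\sqrt{\hat{\boldsymbol x}^\top T^2\hat{\boldsymbol x}}\;d^2\hat{\boldsymbol x};$$ a state $\rho(\boldsymbol 0,T)$ is called a border $T$-state if $\mathcal I(T)=1$. Let $0<a<1$ and $$B(a)=\frac1{\sqrt{1-a}}+\sqrt{\frac{1-a}{a}}\;\operatorname{arcsinh}\sqrt{\frac a{1-a}},\qquad \xi^*(a)=\sqrt{1-a}\;B(a)^{-1}.$$ (i) Let $|\boldsymbol a|=a$ and $\xi\in\mathbb R$, and suppose that $\rho(\boldsymbol a,-\xi I)$ is a state. If $\xi\le(1-a)\,B(a)^{-1}$, then $\rho(\boldsymbol a,-\xi I)$ is non-steerable. More generally, this holds whenever $\xi\le\xi^*(a)$. (ii) Let $u$ be any real number with $\sin^2u=a$. Then $\Phi_{u,u}$ is an extreme point of the convex set of completely positive trace-preserving maps on a qubit. For every $0\le\xi\le\xi^*(a)$ there is a diagonal $T$ such that $\rho(\boldsymbol 0,T)$ is a state, $\mathcal I(T)\le1$, $(\Phi_{u,u}\otimes\mathrm{id})\,\rho(\boldsymbol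 0,T)=\rho(a\hat{\boldsymbol e}_z,-\xi I)$, and $\mathcal I(T)=1$ if and only if $\xi=\xi^*(a)$. Thus the states with $\xi=\xi^*(a)$ are images of border $T$-states. -/

import Mathlib

open MeasureTheory
open scoped ComplexOrder Kronecker Matrix

noncomputable section

namespace QubitSteering

/-- Operators on one qubit. -/
abbrev Op : Type := Matrix (Fin 2) (Fin 2) ℂ

/-- Operators on two qubits; the first factor is Alice's, the second one Bob's. -/
abbrev Op2 : Type := Matrix (Fin 2 × Fin 2) (Fin 2 × Fin 2) ℂ

/-- Three-dimensional Euclidean space, which contains the Bloch vectors. -/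
abbrev E3 : Type := EuclideanSpace ℝ (Fin 3)

/-- The matrices `σ₀ = I, σ₁, σ₂, σ₃`. -/
def pauli : Fin 4 → Op :=
  ![1, !![0, 1; 1, 0], !![0, -Complex.I; Complex.I, 0], !![1, 0; 0, -1]]

/-- Density operators: positive semidefinite of trace one. -/
def IsState {ι : Type} [Fintype ι] (ρ : Matrix ι ι ℂ) : Prop :=
  ρ.PosSemidef ∧ ρ.trace = 1

/-- The operator `(I ⊗ I + a·σ ⊗ I + ∑ᵢⱼ Tᵢⱼ σᵢ ⊗ σⱼ) / 4`, in which Bob's Bloch vector is zero. -/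
def blochState (a : E3) (T : Matrix (Fin 3) (Fin 3) ℝ) : Op2 :=
  (1 / 4 : ℂ) • ((1 : Op) ⊗ₖ (1 : Op)
    + (∑ i : Fin 3, (a i : ℂ) • (pauli i.succ ⊗ₖ (1 : Op)))
    + ∑ i : Fin 3, ∑ j : Fin 3, (T i j : ℂ) • (pauli i.succ ⊗ₖ pauli j.succ))

/-- The displaced Werner operator with Alice's Bloch vector `a` and correlation matrix `-ξ I`. -/
def displacedWerner (a : E3) (ξ : ℝ) : Op2 := blochState a (-(ξ • 1))

/-- The `T`-state operator with correlation matrix `diag t`. -/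
def tState (t : Fin 3 → ℝ) : Op2 := blochState 0 (Matrix.diagonal t)

/-- The unit vector in the `z`-direction. -/
def ez : E3 := EuclideanSpace.single 2 1

/-! ### Steering -/

/-- The partial trace over Alice's qubit. -/
def traceA (X : Op2) : Op := Matrix.of fun j k => ∑ i : Fin 2, X (i, j) (i, k)

/-- Bob's unnormalised conditional state `Tr_A[(E ⊗ I) ρ]` when Alice's outcome has effect `E`. -/
def conditionalState (ρ : Op2) (E : Op) : Op := traceA ((E ⊗ₖ (1 : Op)) * ρ)

/-- A projective measurement with `n` outcomes on one qubit: mutually orthogonal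
orthogonal projections (possibly zero) that sum to the identity. -/
def IsProjectiveMeasurement {n : ℕ} (P : Fin n → Op) : Prop :=
  (∀ i, IsStarProjection (P i)) ∧ (∀ i j, i ≠ j → P i * P j = 0) ∧ ∑ i, P i = 1

/-- `ρ` is non-steerable from Alice to Bob by projective measurements: one ensemble `(μ, σ)` of
local hidden states of Bob reproduces, through response functions `p`, the assemblages of all
the projective measurements of Alice. -/
def NonSteerable (ρ : Op2) : Prop :=
  ∃ (Λ : Type) (_ : MeasurableSpace Λ) (μ : Measure Λ) (σ : Λ → Op),
    IsProbabilityMeasure μ ∧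
    (∀ j k, Measurable fun l => σ l j k) ∧
    (∀ l, IsState (σ l)) ∧
    ∀ (n : ℕ) (P : Fin n → Op), IsProjectiveMeasurement P →
      ∃ p : Fin n → Λ → ℝ,
        (∀ i, Measurable (p i)) ∧
        (∀ i l, 0 ≤ p i l) ∧
        (∀ l, ∑ i, p i l = 1) ∧
        ∀ i j k, conditionalState ρ (P i) j k = ∫ l, (p i l : ℂ) * σ l j k ∂μ

/-- The left-hand side `(1/2π) ∬ √(x̂ᵀ T² x̂) d²x̂` of the equation that defines the border
`T`-states; the integral is over the unit sphere with its surface measure. -/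
def borderIntegral (T : Matrix (Fin 3) (Fin 3) ℝ) : ℝ :=
  1 / (2 * Real.pi) *
    ∫ x : Metric.sphere (0 : E3) 1,
      Real.sqrt ((x : E3).ofLp ⬝ᵥ ((T ^ 2) *ᵥ (x : E3).ofLp)) ∂(volume : Measure E3).toSphere

/-! ### Qubit channels -/

/-- The map `Φ ⊗ id` on operators of a qubit together with an `ι`-dimensional system. -/
def applyA {ι : Type} (Φ : Op →ₗ[ℂ] Op) (X : Matrix (Fin 2 × ι) (Fin 2 × ι) ℂ) :
    Matrix (Fin 2 × ι) (Fin 2 × ι) ℂ :=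
  Matrix.of fun r s => Φ (Matrix.of fun i i' => X (i, r.2) (i', s.2)) r.1 s.1

/-- Completely positive trace-preserving maps on one qubit. -/
def IsCPTP (Φ : Op →ₗ[ℂ] Op) : Prop :=
  (∀ (n : ℕ) (X : Matrix (Fin 2 × Fin n) (Fin 2 × Fin n) ℂ),
    X.PosSemidef → (applyA Φ X).PosSemidef) ∧
  ∀ X : Op, (Φ X).trace = X.trace

/-- The linear map with `Φ(σ_ν) = ∑_μ M_{μν} σ_μ`; the coordinates of `X` in the Pauli basis
are `Tr(σ_ν X) / 2`. -/
def pauliMap (M : Matrix (Fin 4) (Fin 4) ℝ) : Op →ₗ[ℂ] Op where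
  toFun X := ∑ m : Fin 4, ∑ n : Fin 4, ((M m n : ℂ) * ((pauli n * X).trace / 2)) • pauli m
  map_add' X Y := by
    simp only [Matrix.trace_add, add_div, mul_add, add_smul,
      Finset.sum_add_distrib]
  map_smul' c X := by
    simp only [Matrix.mul_smul, Matrix.trace_smul, smul_eq_mul, RingHom.id_apply,
      Finset.smul_sum, smul_smul]
    refine Finset.sum_congr rfl fun m _ => Finset.sum_congr rfl fun n _ => ?_
    congr 1
    ring

/-- The matrix of the extremal qubit channel with parameters `u, v` in the Pauli basis. -/
def extremalMatrix (u v : ℝ) : Matrix (Fin 4) (Fin 4) ℝ :=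
  !![1, 0, 0, 0;
     0, Real.cos u, 0, 0;
     0, 0, Real.cos v, 0;
     Real.sin u * Real.sin v, 0, 0, Real.cos u * Real.cos v]

/-- The extremal qubit channel with parameters `u, v`. -/
def extremalChannel (u v : ℝ) : Op →ₗ[ℂ] Op := pauliMap (extremalMatrix u v)

/-- The quantity `1/√(1-a) + √((1-a)/a) · arcsinh √(a/(1-a))`. -/
def bracket (a : ℝ) : ℝ :=
  1 / Real.sqrt (1 - a) + Real.sqrt ((1 - a) / a) * Real.arsinh (Real.sqrt (a / (1 - a)))

end QubitSteering

end

open MeasureTheory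
open scoped ComplexOrder Kronecker Matrix

noncomputable section

namespace QubitSteering

/-! Write `c = √(1-a)` and `B = bracket a`. Everything rests on the identity `B = ∫_{-1}^1 √(1 + a
z²/(1-a)) dz` (`bracket_eq_integral`). By Archimedes' theorem (`integral_sphere_inner`), the border
integral of a diagonal `T` with entries `±s, ±s, ±s/c` is therefore `s B`.

Part (i), `ξ > 0`: the local model of a `T`-state is pulled back along the damping channel. The
hidden point `x` lies in the unit ball with density proportional to `‖T x‖`, Bob's Bloch vector is
`-T x / ‖T x‖`, and Alice answers with mean `w·m + (2N/π) ‖Q m‖ sign (Q m · x)`, where `N = ∫ ‖T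
x‖`. Here `T` has eigenvalue `ξ/c²` along `w` and `ξ/c` across it, and `Q`, with eigenvalues `c²`
and `c`, is the action of the dual channel on directions, so that `T Q = ξ`. The half-ball moment
`integral_ball_sign_inner` gives the right correlations. The answers are admissible because `2N/π =
ξ B / c ≤ 1` and `‖Q m‖ ≤ 1 - |w·m|`, the positivity of the dual channel
(`nonSteerable_of_ellipsoid`, `nonSteerable_displacedWerner_of_pos`).

Part (i), `ξ ≤ 0`: positivity of the operator gives exactly the inequality needed to write it as a
mixture of six product states (`nonSteerable_displacedWerner_of_nonpos`). The bound with `1-a`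
follows since `1-a ≤ c`.

Part (ii): `Φ_{u,u}` is amplitude damping. Its Choi matrix has a two-dimensional kernel, and this
kernel together with trace preservation determines the channel, whence extremality. The preimage `T`
comes from dividing `-ξ` by the channel's contraction factors, and its border integral is `ξ B / c`.
-/

/-! ### Bloch coordinates of qubit operators and measurements -/

/-- The Hermitian operator `(t I + m·σ) / 2`. -/
def blochOp (t : ℝ) (m : E3) : Op :=
  !![((t : ℂ) + m 2) / 2, ((m 0 : ℂ) - m 1 * Complex.I) / 2;
     ((m 0 : ℂ) + m 1 * Complex.I) / 2, ((t : ℂ) - m 2) / 2]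

lemma exists_blochOp_of_isHermitian {P : Op} (h : P.IsHermitian) :
    ∃ (t : ℝ) (m : E3), P = blochOp t m := by
  refine ⟨(P 0 0).re + (P 1 1).re,
    !₂[2 * (P 0 1).re, -2 * (P 0 1).im, (P 0 0).re - (P 1 1).re], ?_⟩
  have h00 := congrArg Complex.im (h.apply 0 0)
  have h11 := congrArg Complex.im (h.apply 1 1)
  have h10 := h.apply 1 0
  simp at h00 h11
  ext i j
  fin_cases i <;> fin_cases j <;>
    simp [blochOp, Complex.ext_iff] <;> (try rw [← h10]) <;> (try simp) <;> linarith

lemma norm_sq_eq_sum (m : E3) : ‖m‖ ^ 2 = m 0 ^ 2 + m 1 ^ 2 + m 2 ^ 2 := by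
  rw [EuclideanSpace.norm_sq_eq]
  simp [Fin.sum_univ_three]

lemma inner_eq_sum (v w : E3) : inner ℝ v w = v 0 * w 0 + v 1 * w 1 + v 2 * w 2 := by
  simp [PiLp.inner_apply, Fin.sum_univ_three, mul_comm]

lemma trace_blochOp (t : ℝ) (m : E3) : (blochOp t m).trace = t := by
  simp [blochOp, Matrix.trace_fin_two]
  ring

lemma trace_blochOp_mul (t t' : ℝ) (m m' : E3) :
    (blochOp t m * blochOp t' m').trace = ((t * t' + inner ℝ m m') / 2 : ℝ) := by
  rw [inner_eq_sum]
  simp [blochOp, Matrix.trace_fin_two, Complex.ext_iff]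
  constructor <;> ring

/-- The Bloch coordinates of an orthogonal projection on a qubit. -/
lemma blochOp_idempotent {t : ℝ} {m : E3} (h : blochOp t m * blochOp t m = blochOp t m) :
    (m = 0 ∧ (t = 0 ∨ t = 2)) ∨ (t = 1 ∧ ‖m‖ = 1) := by
  have h00 := congrFun (congrFun h 0) 0
  have h01 := congrFun (congrFun h 0) 1
  have h11 := congrFun (congrFun h 1) 1
  simp [blochOp, Matrix.mul_apply, Complex.ext_iff] at h00 h01 h11
  obtain ⟨h00, -⟩ := h00
  obtain ⟨h11, -⟩ := h11
  obtain ⟨h0, h1⟩ := h01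
  have e0 : (t - 1) * m 0 = 0 := by linarith
  have e1 : (t - 1) * m 1 = 0 := by linarith
  have e2 : (t - 1) * m 2 = 0 := by linarith
  have e3 : t ^ 2 + ‖m‖ ^ 2 = 2 * t := by rw [norm_sq_eq_sum]; linarith
  by_cases ht : t = 1
  · right
    refine ⟨ht, ?_⟩
    subst ht
    have : ‖m‖ ^ 2 = 1 := by linarith
    exact (pow_eq_one_iff_of_nonneg (norm_nonneg m) two_ne_zero).mp this
  · left
    have ht' : t - 1 ≠ 0 := sub_ne_zero.mpr ht
    have hm : m = 0 := by
      ext i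
      fin_cases i
      · simpa [ht'] using e0
      · simpa [ht'] using e1
      · simpa [ht'] using e2
    refine ⟨hm, ?_⟩
    subst hm
    have : t * (t - 2) = 0 := by simp at e3; linarith
    rcases mul_eq_zero.mp this with h | h
    · exact Or.inl h
    · exact Or.inr (by linarith)

lemma isState_blochOp {m : E3} (hm : ‖m‖ ≤ 1) : IsState (blochOp 1 m) := by
  refine ⟨?_, by rw [trace_blochOp]; simp⟩
  have hn : m 0 ^ 2 + m 1 ^ 2 + m 2 ^ 2 ≤ 1 := by
    rw [← norm_sq_eq_sum]
    exact pow_le_one₀ (norm_nonneg _) hm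
  refine Matrix.PosSemidef.of_dotProduct_mulVec_nonneg ?_ fun v => ?_
  · ext i j
    fin_cases i <;> fin_cases j <;> simp [blochOp, Complex.ext_iff]
  · have key : ∀ p q r s : ℝ, 0 ≤ (1 + m 2) * (p ^ 2 + q ^ 2) + (1 - m 2) * (r ^ 2 + s ^ 2)
        + 2 * (m 0 * (p * r + q * s) + m 1 * (p * s - q * r)) := by
      intro p q r s
      have h2 : m 2 ^ 2 ≤ 1 := by nlinarith [sq_nonneg (m 0), sq_nonneg (m 1)]
      have h2' := abs_le.mp ((sq_le_one_iff_abs_le_one _).mp h2)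
      rcases eq_or_lt_of_le (by linarith : 0 ≤ 1 + m 2) with h | h
      · have h0 : m 0 = 0 := by nlinarith [sq_nonneg (m 0), sq_nonneg (m 1)]
        have h1 : m 1 = 0 := by nlinarith [sq_nonneg (m 0), sq_nonneg (m 1)]
        rw [← h, h0, h1]
        nlinarith [sq_nonneg r, sq_nonneg s]
      -- Completing the square in the first component after multiplying by the positive corner
      -- entry; the remainder carries the determinant `1 - ‖m‖²`.
      · have : 0 ≤ (1 + m 2) * ((1 + m 2) * (p ^ 2 + q ^ 2) + (1 - m 2) * (r ^ 2 + s ^ 2)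
            + 2 * (m 0 * (p * r + q * s) + m 1 * (p * s - q * r))) := by
          have e : (1 + m 2) * ((1 + m 2) * (p ^ 2 + q ^ 2) + (1 - m 2) * (r ^ 2 + s ^ 2)
            + 2 * (m 0 * (p * r + q * s) + m 1 * (p * s - q * r))) =
            ((1 + m 2) * p + m 0 * r + m 1 * s) ^ 2 + ((1 + m 2) * q + m 0 * s - m 1 * r) ^ 2
            + (1 - (m 0 ^ 2 + m 1 ^ 2 + m 2 ^ 2)) * (r ^ 2 + s ^ 2) := by ring
          rw [e]
          have : 0 ≤ 1 - (m 0 ^ 2 + m 1 ^ 2 + m 2 ^ 2) := by linarith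
          positivity
        exact nonneg_of_mul_nonneg_right this h
    have k := key (v 0).re (v 0).im (v 1).re (v 1).im
    rw [Complex.le_def]
    simp [blochOp, dotProduct, Matrix.mulVec, Fin.sum_univ_two]
    constructor
    · linarith
    · ring

lemma conditionalState_displacedWerner (w : E3) (ξ t : ℝ) (m : E3) :
    conditionalState (displacedWerner w ξ) (blochOp t m) =
      (1 / 2 : ℂ) • blochOp (t + inner ℝ w m) (-(ξ • m)) := by
  rw [inner_eq_sum]
  ext j k
  fin_cases j <;> fin_cases k <;>
    simp [conditionalState, traceA, displacedWerner, blochState, pauli, Matrix.mul_apply,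
      Fintype.sum_prod_type, Fin.sum_univ_succ, Matrix.one_apply, blochOp, Complex.ext_iff] <;>
    (try constructor) <;> ring

/-- The Bloch coordinates of the elements of a projective measurement on a qubit: up to
trivial outcomes there are just two, with opposite Bloch vectors. -/
lemma IsProjectiveMeasurement.exists_bloch {n : ℕ} {P : Fin n → Op}
    (hP : IsProjectiveMeasurement P) :
    ∃ (t : Fin n → ℝ) (m : Fin n → E3), (∀ i, P i = blochOp (t i) (m i)) ∧
      (∀ i, (m i = 0 ∧ (t i = 0 ∨ t i = 2)) ∨ (t i = 1 ∧ ‖m i‖ = 1)) ∧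
      ∑ i, t i = 2 ∧
      ∃ (e : E3) (c : Fin n → ℝ), ∑ i, c i = 0 ∧
        ∀ i, m i = c i • e ∧ (c i = 0 ∨ c i = 1 ∨ c i = -1) := by
  obtain ⟨hproj, horth, hsum⟩ := hP
  have hex := fun i => exists_blochOp_of_isHermitian (P := P i)
    (by have := (hproj i).isSelfAdjoint; exact this)
  choose t m htm using hex
  have hcl : ∀ i, (m i = 0 ∧ (t i = 0 ∨ t i = 2)) ∨ (t i = 1 ∧ ‖m i‖ = 1) := fun i => by
    apply blochOp_idempotent
    rw [← htm i]
    exact (hproj i).isIdempotentElem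
  have ht : ∑ i, t i = 2 := by
    have := congrArg Matrix.trace hsum
    rw [Matrix.trace_sum] at this
    simp only [htm, trace_blochOp, Matrix.trace_one, Fintype.card_fin] at this
    exact_mod_cast this
  refine ⟨t, m, htm, hcl, ht, ?_⟩
  by_cases h : ∀ i, m i = 0
  · exact ⟨0, 0, by simp, fun i => by simp [h i]⟩
  · push Not at h
    obtain ⟨i₀, hi₀⟩ := h
    have hi : t i₀ = 1 ∧ ‖m i₀‖ = 1 := by
      rcases hcl i₀ with h | h
      · exact absurd h.1 hi₀
      · exact h
    have hj : ∀ j, j ≠ i₀ → m j = -t j • m i₀ ∧ (t j = 0 ∨ t j = 1) := by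
      intro j hj
      have h0 := congrArg Matrix.trace (horth i₀ j hj.symm)
      rw [htm i₀, htm j, trace_blochOp_mul, Matrix.trace_zero] at h0
      have h1 : t i₀ * t j + inner ℝ (m i₀) (m j) = 0 := by
        have : (t i₀ * t j + inner ℝ (m i₀) (m j)) / 2 = 0 := by exact_mod_cast h0
        linarith
      rw [hi.1, one_mul] at h1
      rcases hcl j with ⟨hm, h | h⟩ | ⟨h, hm⟩
      · simp [hm, h]
      · rw [hm, h] at h1
        simp at h1
      · have h2 : ‖m i₀ + m j‖ ^ 2 = 0 := by
          rw [norm_add_sq_real, hi.2, hm]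
          linarith
        have h3 : m i₀ + m j = 0 := by simpa using h2
        refine ⟨?_, Or.inr h⟩
        rw [h, neg_one_smul]
        exact eq_neg_of_add_eq_zero_right h3
    -- The traces sum to `2` and `t i₀ = 1`, so the other `t i` sum to `1` and the coefficients
    -- cancel.
    refine ⟨m i₀, fun i => if i = i₀ then 1 else -t i, ?_, fun i => ?_⟩
    · have := Finset.sum_erase_add Finset.univ t (Finset.mem_univ i₀)
      rw [← Finset.sum_erase_add Finset.univ _ (Finset.mem_univ i₀), if_pos rfl,
        Finset.sum_congr rfl (g := fun i => -t i) (fun x hx => if_neg (Finset.ne_of_mem_erase hx)),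
        Finset.sum_neg_distrib]
      linarith [hi.1]
    · by_cases h : i = i₀
      · simp [h]
      · obtain ⟨h1, h2⟩ := hj i h
        simp only [if_neg h]
        refine ⟨h1, ?_⟩
        rcases h2 with h2 | h2 <;> simp [h2]

/-! ### The amplitude damping channel -/

lemma extremalChannel_eq (u : ℝ) (X : Op) :
    extremalChannel u u X =
      !![X 0 0 + Real.sin u ^ 2 * X 1 1, Real.cos u * X 0 1;
         Real.cos u * X 1 0, Real.cos u ^ 2 * X 1 1] := by
  have hs : (Complex.sin u) ^ 2 = 1 - Complex.cos u ^ 2 := by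
    rw [← Complex.sin_sq_add_cos_sq (u : ℂ)]; ring
  ext i j
  fin_cases i <;> fin_cases j <;>
    simp [extremalChannel, pauliMap, extremalMatrix, pauli, Fin.sum_univ_succ,
      Matrix.trace_fin_two, Matrix.mul_apply, Matrix.smul_apply] <;>
    ring_nf <;> (try simp only [hs, Complex.I_sq]) <;> ring

/-- The Kraus operator `diag(1, cos u) ⊗ 1`. -/
def krausNoDecay (ι : Type) [DecidableEq ι] (u : ℝ) : Matrix (Fin 2 × ι) (Fin 2 × ι) ℂ :=
  !![1, 0; 0, (Real.cos u : ℂ)] ⊗ₖ (1 : Matrix ι ι ℂ)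

/-- The Kraus operator `sin u |0⟩⟨1| ⊗ 1`. -/
def krausDecay (ι : Type) [DecidableEq ι] (u : ℝ) : Matrix (Fin 2 × ι) (Fin 2 × ι) ℂ :=
  !![0, (Real.sin u : ℂ); 0, 0] ⊗ₖ (1 : Matrix ι ι ℂ)

lemma applyA_extremalChannel {ι : Type} [Fintype ι] [DecidableEq ι] (u : ℝ)
    (X : Matrix (Fin 2 × ι) (Fin 2 × ι) ℂ) :
    applyA (extremalChannel u u) X =
      krausNoDecay ι u * X * (krausNoDecay ι u)ᴴ + krausDecay ι u * X * (krausDecay ι u)ᴴ := by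
  ext ⟨i, k⟩ ⟨j, l⟩
  simp only [applyA, extremalChannel_eq]
  fin_cases i <;> fin_cases j <;>
    simp [krausNoDecay, krausDecay, Matrix.mul_apply, Fintype.sum_prod_type, Fin.sum_univ_two,
      Matrix.one_apply, apply_ite (starRingEnd ℂ), ← Complex.cos_conj, ← Complex.sin_conj] <;>
    ring

lemma isCPTP_extremalChannel (u : ℝ) : IsCPTP (extremalChannel u u) := by
  refine ⟨fun n X hX => ?_, fun X => ?_⟩
  · rw [applyA_extremalChannel]
    exact (hX.mul_mul_conjTranspose_same _).add (hX.mul_mul_conjTranspose_same _)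
  · rw [extremalChannel_eq, Matrix.trace_fin_two, Matrix.trace_fin_two]
    have : (Complex.sin u) ^ 2 = 1 - Complex.cos u ^ 2 := by
      rw [← Complex.sin_sq_add_cos_sq (u : ℂ)]; ring
    simp [this]
    ring

/-! ### Extremality through the kernel of the Choi matrix -/

/-- The unnormalised maximally entangled state of two qubits. -/
def maxEntangled : Op2 := Matrix.of fun r s => if r.1 = r.2 ∧ s.1 = s.2 then 1 else 0

lemma maxEntangled_posSemidef : maxEntangled.PosSemidef := by
  have : maxEntangled = Matrix.vecMulVec (fun r : Fin 2 × Fin 2 => if r.1 = r.2 then (1 : ℂ) else 0)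
      (star fun r : Fin 2 × Fin 2 => if r.1 = r.2 then (1 : ℂ) else 0) := by
    ext r s
    by_cases h1 : r.1 = r.2 <;> by_cases h2 : s.1 = s.2 <;>
      simp [maxEntangled, Matrix.vecMulVec_apply, h1, h2]
  rw [this]
  exact Matrix.posSemidef_vecMulVec_self_star _

/-- The Choi matrix of a linear map on qubit operators. -/
def choi (Φ : Op →ₗ[ℂ] Op) : Op2 := applyA Φ maxEntangled

lemma choi_apply (Φ : Op →ₗ[ℂ] Op) (i j k l : Fin 2) :
    choi Φ (i, k) (j, l) = Φ (Matrix.single k l 1) i j := by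
  have : (Matrix.of fun a b => maxEntangled (a, k) (b, l)) = Matrix.single k l (1 : ℂ) := by
    ext a b
    simp [maxEntangled, Matrix.single_apply, eq_comm]
  simp [choi, applyA, this]

lemma IsCPTP.choi_posSemidef {Φ : Op →ₗ[ℂ] Op} (h : IsCPTP Φ) : (choi Φ).PosSemidef :=
  h.1 2 _ maxEntangled_posSemidef

lemma choi_add_smul (p q : ℝ) (Φ Ψ : Op →ₗ[ℂ] Op) :
    choi (p • Φ + q • Ψ) = p • choi Φ + q • choi Ψ := by
  ext ⟨i, k⟩ ⟨j, l⟩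
  simp [choi_apply]

/-- The kernel of a positive semidefinite matrix is the zero set of its quadratic form, and two
nonnegative forms with a vanishing positive combination vanish separately. -/
lemma mulVec_eq_zero_of_convex_comb {n : Type*} [Fintype n] [DecidableEq n]
    {A B : Matrix n n ℂ} (hA : A.PosSemidef) (hB : B.PosSemidef) {p q : ℝ} (hp : 0 < p)
    (hq : 0 < q) {v : n → ℂ} (hv : (p • A + q • B) *ᵥ v = 0) : A *ᵥ v = 0 := by
  rw [← hA.dotProduct_mulVec_zero_iff]
  have h0 : p • (star v ⬝ᵥ A *ᵥ v) + q • (star v ⬝ᵥ B *ᵥ v) = 0 := by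
    have := congrArg (fun y => star v ⬝ᵥ y) hv
    simpa [Matrix.add_mulVec, Matrix.smul_mulVec, dotProduct_add, dotProduct_smul] using this
  have h1 := hA.dotProduct_mulVec_nonneg v
  have h2 := hB.dotProduct_mulVec_nonneg v
  rw [Complex.le_def] at h1 h2
  have h3 := congrArg Complex.re h0
  simp only [Complex.add_re, Complex.real_smul, Complex.re_ofReal_mul, Complex.zero_re] at h3
  have h4 : (star v ⬝ᵥ A *ᵥ v).re = 0 := by
    have a1 := mul_nonneg hp.le h1.1
    have a2 := mul_nonneg hq.le h2.1
    have : p * (star v ⬝ᵥ A *ᵥ v).re = 0 := by linarith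
    simpa [hp.ne'] using this
  exact Complex.ext h4 h1.2.symm

/-- A trace-preserving map with positive semidefinite Choi matrix whose kernel contains that of
the Choi matrix of the amplitude damping channel is that channel. -/
lemma eq_extremalChannel_of_kernel (u : ℝ) {Φ : Op →ₗ[ℂ] Op} (hΦ : IsCPTP Φ)
    (h1 : choi Φ *ᵥ Pi.single (1, 0) 1 = 0)
    (h2 : choi Φ *ᵥ ((Real.cos u : ℂ) • Pi.single (0, 0) 1 - Pi.single (1, 1) 1) = 0) :
    Φ = extremalChannel u u := by
  have hherm : ∀ i j k l, Φ (Matrix.single k l 1) i j = star (Φ (Matrix.single l k 1) j i) := by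
    intro i j k l
    have := hΦ.choi_posSemidef.isHermitian.apply (i, k) (j, l)
    rw [choi_apply, choi_apply] at this
    exact this.symm
  -- The two kernel vectors express the second column of every `Φ(|k⟩⟨l|)` through the first.
  -- Hermiticity and the trace then fix what remains.
  have c1 : ∀ i k, Φ (Matrix.single k 0 1) i 1 = 0 := by
    intro i k
    have := congrFun h1 (i, k)
    simpa [choi_apply] using this
  have c2 : ∀ i k, Φ (Matrix.single k 1 1) i 1 = Real.cos u * Φ (Matrix.single k 0 1) i 0 := by
    intro i k
    have := congrFun h2 (i, k)
    rw [Matrix.mulVec_sub, Matrix.mulVec_smul] at this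
    simp [choi_apply] at this
    simpa using (sub_eq_zero.mp this).symm
  have tr : ∀ k l, Φ (Matrix.single k l 1) 0 0 + Φ (Matrix.single k l 1) 1 1 =
      (Matrix.single k l (1 : ℂ)).trace := by
    intro k l
    rw [← hΦ.2, Matrix.trace_fin_two]
  have a00 : Φ (Matrix.single 0 0 1) = !![1, 0; 0, 0] := by
    have t := tr 0 0
    rw [c1] at t
    have o := hherm 1 0 0 0
    rw [c1] at o
    ext i j
    fin_cases i <;> fin_cases j <;> simp [c1, o]
    simpa using t
  have a10 : Φ (Matrix.single 1 0 1) = !![0, 0; (Real.cos u : ℂ), 0] := by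
    have t := tr 1 0
    rw [c1] at t
    have o := hherm 1 0 1 0
    rw [c2, a00] at o
    ext i j
    fin_cases i <;> fin_cases j
    · simpa using t
    · simp [c1]
    · simp [o, ← Complex.cos_conj]
    · simp [c1]
  have a01 : Φ (Matrix.single 0 1 1) = !![0, (Real.cos u : ℂ); 0, 0] := by
    ext i j
    rw [hherm, a10]
    fin_cases i <;> fin_cases j <;> simp [← Complex.cos_conj]
  have a11 : Φ (Matrix.single 1 1 1) = !![(Real.sin u : ℂ) ^ 2, 0; 0, (Real.cos u : ℂ) ^ 2] := by
    have t := tr 1 1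
    have o := hherm 1 0 1 1
    rw [c2, a10] at t o
    have hs : (Complex.sin u) ^ 2 = 1 - Complex.cos u ^ 2 := by
      rw [← Complex.sin_sq_add_cos_sq (u : ℂ)]; ring
    ext i j
    fin_cases i <;> fin_cases j
    · simp at t
      simp [hs]
      linear_combination t
    · simp [c2, a10]
    · simpa using o
    · simp [c2, a10]
      ring
  refine LinearMap.ext fun X => ?_
  rw [extremalChannel_eq]
  have hX : X = X 0 0 • Matrix.single 0 0 1 + X 0 1 • Matrix.single 0 1 1
      + X 1 0 • Matrix.single 1 0 1 + X 1 1 • Matrix.single 1 1 1 := by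
    ext i j
    fin_cases i <;> fin_cases j <;> simp
  conv_lhs => rw [hX]
  simp only [map_add, map_smul, a00, a01, a10, a11]
  ext i j
  fin_cases i <;> fin_cases j <;> simp <;> ring

lemma choi_extremalChannel_kernel (u : ℝ) :
    choi (extremalChannel u u) *ᵥ Pi.single (1, 0) 1 = 0 ∧
    choi (extremalChannel u u) *ᵥ
      ((Real.cos u : ℂ) • Pi.single (0, 0) 1 - Pi.single (1, 1) 1) = 0 := by
  constructor
  · ext ⟨i, k⟩
    fin_cases i <;> fin_cases k <;> simp [choi_apply, extremalChannel_eq]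
  · rw [Matrix.mulVec_sub, Matrix.mulVec_smul]
    ext ⟨i, k⟩
    fin_cases i <;> fin_cases k <;> simp [choi_apply, extremalChannel_eq]
    ring

/-- Any component of a convex decomposition inherits the Choi kernel of the mixture, which leaves
only the channel itself. -/
lemma extremalChannel_mem_extremePoints (u : ℝ) :
    extremalChannel u u ∈ Set.extremePoints ℝ {Φ | IsCPTP Φ} := by
  refine ⟨isCPTP_extremalChannel u, ?_⟩
  rintro Φ hΦ Ψ hΨ ⟨p, q, hp, hq, -, h⟩
  obtain ⟨k1, k2⟩ := choi_extremalChannel_kernel u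
  rw [← h, choi_add_smul] at k1 k2
  exact eq_extremalChannel_of_kernel u hΦ
    (mulVec_eq_zero_of_convex_comb hΦ.choi_posSemidef hΨ.choi_posSemidef hp hq k1)
    (mulVec_eq_zero_of_convex_comb hΦ.choi_posSemidef hΨ.choi_posSemidef hp hq k2)

/-! ### `T`-states -/

/-- The eigenvalues are `(1+z)/4`, twice, and `(1-z±2x)/4`; the last two come from the block on
`|01⟩, |10⟩`. -/
lemma isState_tState {x z : ℝ} (h1 : |z| ≤ 1) (h2 : 2 * |x| ≤ 1 - z) :
    IsState (tState ![x, x, z]) := by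
  obtain ⟨h1, h1'⟩ := abs_le.mp h1
  have h3 := neg_abs_le x
  have h4 := le_abs_self x
  constructor
  · refine Matrix.PosSemidef.of_dotProduct_mulVec_nonneg ?_ fun v => ?_
    · ext ⟨i, k⟩ ⟨j, l⟩
      fin_cases i <;> fin_cases j <;> fin_cases k <;> fin_cases l <;>
        simp [tState, blochState, pauli, Fin.sum_univ_succ] <;> ring
    · have key : ∀ p q : ℝ, 0 ≤ (1 - z) * (p ^ 2 + q ^ 2) + 4 * x * (p * q) := by
        intro p q
        nlinarith [mul_nonneg (by linarith : 0 ≤ 1 - z + 2 * x) (sq_nonneg (p + q)),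
          mul_nonneg (by linarith : 0 ≤ 1 - z - 2 * x) (sq_nonneg (p - q))]
      have k1 := key (v (0, 1)).re (v (1, 0)).re
      have k2 := key (v (0, 1)).im (v (1, 0)).im
      have k3 : 0 ≤ (1 + z) * ((v (0, 0)).re ^ 2 + (v (0, 0)).im ^ 2 + (v (1, 1)).re ^ 2
          + (v (1, 1)).im ^ 2) := mul_nonneg (by linarith) (by positivity)
      rw [Complex.le_def]
      simp [tState, blochState, pauli, Fin.sum_univ_succ, Matrix.one_apply, dotProduct,
        Matrix.mulVec, Fintype.sum_prod_type]
      constructor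
      · linarith
      · ring
  · simp [tState, blochState, pauli, Fin.sum_univ_succ, Matrix.trace, Fintype.sum_prod_type]
    ring

/-- The channel contracts the first two Bloch directions by `cos u` and the third by `cos² u`, which
undoes the divisions, and it displaces the centre by `sin² u = a`. -/
lemma applyA_tState {a ξ u : ℝ} (hu : Real.sin u * Real.sin u = a) (hc : Real.cos u ≠ 0) :
    applyA (extremalChannel u u)
      (tState ![-ξ / Real.cos u, -ξ / Real.cos u, -ξ / Real.cos u ^ 2]) =
    displacedWerner (a • ez) ξ := by
  have hc' : Complex.cos u ≠ 0 := by exact_mod_cast hc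
  have hs : Complex.sin u ^ 2 = a := by rw [← hu]; push_cast; ring
  have hs' : Complex.cos u ^ 2 = 1 - a := by
    rw [← hs, ← Complex.sin_sq_add_cos_sq (u : ℂ)]; ring
  have hne : (1 - a : ℂ) ≠ 0 := by rw [← hs']; exact pow_ne_zero 2 hc'
  ext ⟨i, k⟩ ⟨j, l⟩
  simp only [applyA, extremalChannel_eq]
  fin_cases i <;> fin_cases j <;> fin_cases k <;> fin_cases l <;>
    simp [tState, displacedWerner, blochState, pauli, Fin.sum_univ_succ, ez, Matrix.one_apply,
      hs, hs'] <;> field_simp <;> ring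

/-! ### Integrals over the unit ball and the unit sphere -/

lemma exists_orthonormalBasis_apply_zero {e : E3} (he : ‖e‖ = 1) :
    ∃ b : OrthonormalBasis (Fin 3) ℝ E3, b 0 = e := by
  obtain ⟨b, hb⟩ := Orthonormal.exists_orthonormalBasis_extension_of_card_eq
    (𝕜 := ℝ) (E := E3) (ι := Fin 3) (by simp) (v := fun _ => e) (s := {0})
    (by
      rw [orthonormal_iff_ite]
      rintro ⟨i, hi⟩ ⟨j, hj⟩
      simp only [Set.mem_singleton_iff] at hi hj
      subst hi hj
      simp [he])
  exact ⟨b, hb 0 rfl⟩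

/-- Integration over the unit ball of a function of one Cartesian coordinate, by slices. -/
lemma integral_ball_coord {h : ℝ → ℝ} (hh : Continuous h) :
    ∫ x in Metric.ball (0 : E3) 1, h (x 0) =
      Real.pi * ∫ z in (-1 : ℝ)..1, h z * (1 - z ^ 2) := by
  set G : ℝ × EuclideanSpace ℝ (Fin 2) → ℝ :=
    {p | p.1 ^ 2 + ‖p.2‖ ^ 2 < 1}.indicator fun p => h p.1 with hG
  set S : Set (ℝ × EuclideanSpace ℝ (Fin 2)) := {p | p.1 ^ 2 + ‖p.2‖ ^ 2 < 1} with hS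
  have hSm : MeasurableSet S := by
    apply measurableSet_lt <;> fun_prop
  have hmp : MeasurePreserving
      (fun x : E3 => ((x 0, WithLp.toLp 2 (fun i : Fin 2 => x i.succ)) :
        ℝ × EuclideanSpace ℝ (Fin 2))) volume volume := by
    have h1 := PiLp.volume_preserving_ofLp (Fin 3)
    have h2 := volume_preserving_piFinSuccAbove (fun _ : Fin 3 => ℝ) 0
    have h3 : MeasurePreserving (Prod.map (id : ℝ → ℝ) (@WithLp.toLp 2 (Fin 2 → ℝ)))
        (volume.prod volume) (volume.prod volume) :=
      (MeasurePreserving.id volume).prod (PiLp.volume_preserving_toLp (Fin 2))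
    exact h3.comp (h2.comp h1)
  have hSfin : volume S < ⊤ := by
    refine lt_of_le_of_lt (measure_mono (t := Metric.ball 0 1) ?_) measure_ball_lt_top
    rintro ⟨z, y⟩ hp
    simp only [hS, Set.mem_ofPred_eq] at hp
    rw [mem_ball_zero_iff, Prod.norm_mk, max_lt_iff]
    constructor
    · rw [Real.norm_eq_abs, ← sq_lt_one_iff_abs_lt_one]
      nlinarith [sq_nonneg ‖y‖]
    · nlinarith [sq_nonneg z, norm_nonneg y]
  have hbdd : ∃ C, ∀ p ∈ S, ‖h p.1‖ ≤ C := by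
    obtain ⟨C, hC⟩ := (isCompact_Icc (a := (-1 : ℝ)) (b := 1)).exists_bound_of_continuousOn
      hh.continuousOn
    refine ⟨C, fun p hp => hC _ ?_⟩
    simp only [hS, Set.mem_ofPred_eq] at hp
    exact abs_le.mp ((sq_le_one_iff_abs_le_one _).mp (by nlinarith [sq_nonneg ‖p.2‖]))
  have hGint : Integrable G (volume.prod volume) := by
    rw [hG, integrable_indicator_iff hSm]
    obtain ⟨C, hC⟩ := hbdd
    refine Measure.integrableOn_of_bounded (M := C) hSfin.ne
      (by fun_prop) ?_
    filter_upwards [ae_restrict_mem hSm] with p hp using hC p hp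
  have e1 : ∫ x in Metric.ball (0 : E3) 1, h (x 0) = ∫ p, G p := by
    have hmap := integral_map hmp.aemeasurable
      (f := G) (by rw [hmp.map_eq]; exact hGint.aestronglyMeasurable)
    rw [hmp.map_eq] at hmap
    rw [hmap, ← integral_indicator measurableSet_ball]
    refine integral_congr_ae (Filter.Eventually.of_forall fun x => ?_)
    simp only [hG, hS, Set.indicator, Set.mem_ofPred_eq, mem_ball_zero_iff]
    congr 1
    rw [← sq_lt_one_iff₀ (norm_nonneg x), EuclideanSpace.norm_sq_eq, EuclideanSpace.norm_sq_eq,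
      Fin.sum_univ_succ]
    simp
  have e2 : ∀ z : ℝ, ∫ y : EuclideanSpace ℝ (Fin 2), G (z, y) =
      (Set.Ioc (-1) 1).indicator (fun z => Real.pi * (h z * (1 - z ^ 2))) z := by
    intro z
    have : (fun y => G (z, y)) =
        (Metric.ball (0 : EuclideanSpace ℝ (Fin 2)) (Real.sqrt (1 - z ^ 2))).indicator
          fun _ => h z := by
      ext y
      simp only [hG, hS, Set.indicator, Set.mem_ofPred_eq, mem_ball_zero_iff]
      congr 1
      rw [Real.lt_sqrt (norm_nonneg _), eq_iff_iff]
      constructor <;> intro <;> linarith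
    rw [this, integral_indicator measurableSet_ball, setIntegral_const, Measure.real,
      EuclideanSpace.volume_ball_fin_two]
    by_cases hz : z ∈ Set.Ioc (-1 : ℝ) 1
    · have : 0 ≤ 1 - z ^ 2 := by nlinarith [hz.1, hz.2]
      rw [Set.indicator_of_mem hz]
      simp [← ENNReal.ofReal_pow (Real.sqrt_nonneg _), Real.sq_sqrt this, this]
      rw [ENNReal.toReal_ofReal Real.pi_pos.le]
      ring
    · rw [Set.indicator_of_notMem hz]
      have : 1 - z ^ 2 ≤ 0 := by
        by_contra hc
        push Not at hc
        apply hz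
        have := abs_lt.mp ((sq_lt_one_iff_abs_lt_one z).mp (by linarith))
        exact ⟨this.1, this.2.le⟩
      -- Here `1 - z² ≤ 0`, where the square root is `0` (by default if the argument is negative),
      -- so the slice is empty.
      simp [Real.sqrt_eq_zero_of_nonpos this]
  rw [e1, Measure.volume_eq_prod, integral_prod _ hGint]
  simp only [e2]
  rw [integral_indicator measurableSet_Ioc, ← intervalIntegral.integral_of_le (by norm_num),
    intervalIntegral.integral_const_mul]

lemma integral_ball_inner {e : E3} (he : ‖e‖ = 1) {h : ℝ → ℝ} (hh : Continuous h) :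
    ∫ x in Metric.ball (0 : E3) 1, h (inner ℝ e x) =
      Real.pi * ∫ z in (-1 : ℝ)..1, h z * (1 - z ^ 2) := by
  obtain ⟨b, rfl⟩ := exists_orthonormalBasis_apply_zero he
  rw [← integral_ball_coord hh]
  have hb := b.repr.measurePreserving
  rw [← hb.setIntegral_preimage_emb (g := fun x : E3 => h (x 0)) b.repr.toHomeomorph.measurableEmbedding]
  congr 1
  · congr 1
    ext x
    simp
  · ext x
    simp [b.repr_apply_apply]

/-- Integration in polar coordinates of a function with separated variables. -/
lemma integral_polar (k : ℝ → ℝ) (f : E3 → ℝ) :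
    ∫ x : E3, k ‖x‖ * f (‖x‖⁻¹ • x) =
      (∫ x : Metric.sphere (0 : E3) 1, f x ∂(volume : Measure E3).toSphere) *
        ∫ r in Set.Ioi (0 : ℝ), r ^ 2 * k r := by
  have hfin : Module.finrank ℝ E3 = 3 := by simp
  calc
    ∫ x : E3, k ‖x‖ * f (‖x‖⁻¹ • x)
      = ∫ x : ({(0)}ᶜ : Set E3), k ‖x.1‖ * f (‖x.1‖⁻¹ • x.1) ∂(volume.comap Subtype.val) := by
      rw [integral_subtype_comap (measurableSet_singleton _).compl
        fun x : E3 ↦ k ‖x‖ * f (‖x‖⁻¹ • x), restrict_compl_singleton]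
    _ = ∫ x, k x.2.1 * f x.1 ∂(volume : Measure E3).toSphere.prod (.volumeIoiPow 2) := by
      have := (volume : Measure E3).measurePreserving_homeomorphUnitSphereProd.integral_comp
        (Homeomorph.measurableEmbedding _) (fun p => k p.2.1 * f p.1.1)
      rw [hfin] at this
      simpa using this
    _ = (∫ x : Metric.sphere (0 : E3) 1, f x ∂(volume : Measure E3).toSphere) *
        ∫ r : Set.Ioi (0 : ℝ), k r.1 ∂.volumeIoiPow 2 := by
      rw [← integral_prod_mul]
      simp only [mul_comm]
    _ = _ := by
      congr 1
      simp only [Measure.volumeIoiPow, ENNReal.ofReal]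
      rw [integral_withDensity_eq_integral_smul,
        integral_subtype_comap measurableSet_Ioi fun a ↦ Real.toNNReal (a ^ 2) • k a,
        setIntegral_congr_fun measurableSet_Ioi fun x hx ↦ ?_]
      · rw [NNReal.smul_def, Real.coe_toNNReal _ (pow_nonneg (le_of_lt hx) _), smul_eq_mul]
      · exact (measurable_subtype_coe.pow_const _).real_toNNReal

/-- The radial factor is `∫₀¹ r^(n+2) dr = 1/(n+3)`. This is the bridge between ball integrals,
computed by slices, and surface integrals. -/
lemma integral_ball_homogeneous (n : ℕ) {f : E3 → ℝ}
    (hf : ∀ (r : ℝ) (x : E3), 0 < r → f (r • x) = r ^ n * f x) :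
    ∫ x in Metric.ball (0 : E3) 1, f x =
      (∫ x : Metric.sphere (0 : E3) 1, f x ∂(volume : Measure E3).toSphere) / (n + 3) := by
  have h1 : ∫ x in Metric.ball (0 : E3) 1, f x =
      ∫ x : E3, (Set.Iio 1).indicator (fun r => r ^ n) ‖x‖ * f (‖x‖⁻¹ • x) := by
    rw [← integral_indicator measurableSet_ball]
    refine integral_congr_ae ?_
    have h0 : ∀ᵐ x : E3, x ≠ 0 := by
      simp [ae_iff, measure_singleton]
    filter_upwards [h0] with x hx
    have hx' : 0 < ‖x‖ := norm_pos_iff.mpr hx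
    simp only [Set.indicator, mem_ball_zero_iff, Set.mem_Iio]
    split_ifs
    · rw [← hf _ _ hx', smul_inv_smul₀ hx'.ne']
    · simp
  rw [h1, integral_polar, div_eq_mul_inv]
  congr 1
  have h2 : ∀ r : ℝ, r ^ 2 * (Set.Iio 1).indicator (fun r => r ^ n) r =
      (Set.Iio 1).indicator (fun r => r ^ (n + 2)) r := by
    intro r
    simp only [Set.indicator]
    split_ifs <;> ring
  simp only [h2]
  rw [setIntegral_indicator measurableSet_Iio, Set.Ioi_inter_Iio, ← integral_Ioc_eq_integral_Ioo,
    ← intervalIntegral.integral_of_le zero_le_one, integral_pow]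
  push_cast
  norm_num
  ring

lemma toSphere_real_univ : (volume : Measure E3).toSphere.real Set.univ = 4 * Real.pi := by
  have h := integral_ball_homogeneous 0 (f := fun _ => 1) (by simp)
  have h2 := integral_ball_inner (e := ez) (by simp [ez]) (h := fun _ => 1) (by fun_prop)
  rw [h2] at h
  have h3 : ∫ z in (-1 : ℝ)..1, (1 - z ^ 2) = 4 / 3 := by
    rw [intervalIntegral.integral_sub (by simp) (by simp), integral_pow]
    norm_num
  simp only [one_mul, h3, integral_const, smul_eq_mul] at h
  simp at h ⊢
  linarith

/-- Powers of a coordinate are homogeneous, so the slice formula for the ball yields the surface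
integral; polynomials and, by Weierstrass, continuous functions follow. -/
lemma integral_sphere_pow {e : E3} (he : ‖e‖ = 1) (n : ℕ) :
    ∫ x : Metric.sphere (0 : E3) 1, (inner ℝ e (x : E3)) ^ n ∂(volume : Measure E3).toSphere =
      2 * Real.pi * ∫ z in (-1 : ℝ)..1, z ^ n := by
  have h := integral_ball_homogeneous n (f := fun x => (inner ℝ e x) ^ n)
    (by intro r x _; rw [inner_smul_right, mul_pow])
  rw [integral_ball_inner he (h := fun z => z ^ n) (by fun_prop), eq_div_iff (by positivity)] at h
  rw [← h]
  have h2 : ∀ z : ℝ, z ^ n * (1 - z ^ 2) = z ^ n - z ^ (n + 2) := fun z => by ring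
  simp only [h2]
  rw [intervalIntegral.integral_sub (by simp) (by simp), integral_pow, integral_pow]
  have : (n : ℝ) + 1 ≠ 0 := by positivity
  have : (n : ℝ) + 3 ≠ 0 := by positivity
  have : (n : ℝ) + 2 + 1 ≠ 0 := by positivity
  push_cast
  field_simp
  ring

lemma integral_sphere_polynomial {e : E3} (he : ‖e‖ = 1) (p : Polynomial ℝ) :
    ∫ x : Metric.sphere (0 : E3) 1, p.eval (inner ℝ e (x : E3))
        ∂(volume : Measure E3).toSphere =
      2 * Real.pi * ∫ z in (-1 : ℝ)..1, p.eval z := by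
  simp only [Polynomial.eval_eq_sum_range]
  rw [integral_finsetSum, intervalIntegral.integral_finsetSum, Finset.mul_sum]
  · refine Finset.sum_congr rfl fun i _ => ?_
    rw [integral_const_mul, integral_sphere_pow he, intervalIntegral.integral_const_mul]
    ring
  · intro i _
    exact (by fun_prop : Continuous _).intervalIntegrable _ _
  · intro i _
    exact (by fun_prop : Continuous _).integrable_of_hasCompactSupport
      (HasCompactSupport.of_compactSpace _)

/-- Archimedes' theorem: each coordinate is equidistributed on the unit sphere. -/
lemma integral_sphere_inner {e : E3} (he : ‖e‖ = 1) {g : ℝ → ℝ} (hg : Continuous g) :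
    ∫ x : Metric.sphere (0 : E3) 1, g (inner ℝ e (x : E3)) ∂(volume : Measure E3).toSphere =
      2 * Real.pi * ∫ z in (-1 : ℝ)..1, g z := by
  refine eq_of_forall_dist_le fun ε hε => ?_
  -- The tolerance costs `ε/2` on the sphere, of area `4π`, and `ε/2` on the interval, of length `2`
  -- with prefactor `2π`.
  obtain ⟨p, hp⟩ := exists_polynomial_near_of_continuousOn (-1) 1 g hg.continuousOn
    (ε / (8 * Real.pi)) (by positivity)
  have hmem : ∀ x : Metric.sphere (0 : E3) 1, inner ℝ e (x : E3) ∈ Set.Icc (-1 : ℝ) 1 := by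
    intro x
    have := abs_real_inner_le_norm e (x : E3)
    rw [he, norm_eq_of_mem_sphere x, one_mul] at this
    exact abs_le.mp this
  have hcont : ∀ {f : ℝ → ℝ}, Continuous f → Integrable
      (fun x : Metric.sphere (0 : E3) 1 => f (inner ℝ e (x : E3)))
      (volume : Measure E3).toSphere := fun hf =>
    (by fun_prop : Continuous _).integrable_of_hasCompactSupport
      (HasCompactSupport.of_compactSpace _)
  have b1 : |(∫ x : Metric.sphere (0 : E3) 1, g (inner ℝ e (x : E3))
        ∂(volume : Measure E3).toSphere) - ∫ x : Metric.sphere (0 : E3) 1,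
        p.eval (inner ℝ e (x : E3)) ∂(volume : Measure E3).toSphere| ≤ ε / 2 := by
    rw [← integral_sub (hcont hg) (hcont p.continuous), ← Real.norm_eq_abs]
    refine (norm_integral_le_of_norm_le_const (C := ε / (8 * Real.pi))
      (Filter.Eventually.of_forall fun x => ?_)).trans_eq ?_
    · rw [Real.norm_eq_abs, abs_sub_comm]
      exact (hp _ (hmem x)).le
    · rw [toSphere_real_univ]
      field_simp
      norm_num
  have b2 : |(∫ z in (-1 : ℝ)..1, p.eval z) - ∫ z in (-1 : ℝ)..1, g z|
      ≤ ε / (8 * Real.pi) * 2 := by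
    rw [← intervalIntegral.integral_sub (p.continuous.intervalIntegrable _ _)
      (hg.intervalIntegrable _ _), ← Real.norm_eq_abs]
    refine (intervalIntegral.norm_integral_le_of_norm_le_const
      (C := ε / (8 * Real.pi)) fun x hx => ?_).trans_eq ?_
    · rw [Set.uIoc_of_le (by norm_num)] at hx
      exact (hp x (Set.Ioc_subset_Icc_self hx)).le
    · norm_num
  rw [integral_sphere_polynomial he] at b1
  have b3 : |2 * Real.pi * (∫ z in (-1 : ℝ)..1, p.eval z) - 2 * Real.pi * ∫ z in (-1 : ℝ)..1, g z|
      ≤ ε / 2 := by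
    rw [← mul_sub, abs_mul, abs_of_pos (by positivity)]
    refine (mul_le_mul_of_nonneg_left b2 (by positivity)).trans_eq ?_
    field_simp
    norm_num
  rw [Real.dist_eq]
  have := abs_add_le _ _ |>.trans (add_le_add b1 b3)
  rwa [sub_add_sub_cancel, add_halves] at this

/-! ### The bracket and the border integral -/

lemma integral_sqrt_one_add_sq {k : ℝ} (hk : k ≠ 0) :
    ∫ z in (-1 : ℝ)..1, Real.sqrt (1 + (k * z) ^ 2) =
      Real.sqrt (1 + k ^ 2) + k⁻¹ * Real.arsinh k := by
  -- The antiderivative is odd, so the two endpoints contribute equally and cancel its factor `1/2`.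
  have hd : ∀ z : ℝ, HasDerivAt (fun z => (z * Real.sqrt (1 + (k * z) ^ 2)
      + k⁻¹ * Real.arsinh (k * z)) / 2) (Real.sqrt (1 + (k * z) ^ 2)) z := by
    intro z
    have hpos : 0 < 1 + (k * z) ^ 2 := by positivity
    have h1 : HasDerivAt (fun z : ℝ => k * z) k z := by
      simpa using (hasDerivAt_id z).const_mul k
    have h2 := ((h1.pow 2).const_add 1).sqrt hpos.ne'
    have h3 := (((hasDerivAt_id z).mul h2).add (h1.arsinh.const_mul k⁻¹)).div_const 2
    refine h3.congr_deriv ?_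
    have hs : Real.sqrt (1 + (k * z) ^ 2) ≠ 0 := (Real.sqrt_pos.mpr hpos).ne'
    have hsq := Real.sq_sqrt hpos.le
    simp only [id, Pi.pow_apply, smul_eq_mul, Nat.cast_ofNat, Nat.add_one_sub_one, pow_one]
    generalize Real.sqrt (1 + (k * z) ^ 2) = t at hs hsq ⊢
    field_simp
    rw [hsq]
    ring
  rw [intervalIntegral.integral_eq_sub_of_hasDerivAt (fun z _ => hd z)
    ((by fun_prop : Continuous _).intervalIntegrable _ _)]
  simp [Real.arsinh_neg]
  ring

lemma bracket_eq_integral {a : ℝ} (ha0 : 0 < a) (ha1 : a < 1) :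
    bracket a = ∫ z in (-1 : ℝ)..1, Real.sqrt (1 + a / (1 - a) * z ^ 2) := by
  have h1 : 0 < 1 - a := by linarith
  have hk : 0 < a / (1 - a) := by positivity
  have h2 : ∀ z : ℝ, 1 + a / (1 - a) * z ^ 2 = 1 + (Real.sqrt (a / (1 - a)) * z) ^ 2 := by
    intro z
    rw [mul_pow, Real.sq_sqrt hk.le]
  simp only [h2]
  rw [integral_sqrt_one_add_sq (Real.sqrt_pos.mpr hk).ne', Real.sq_sqrt hk.le, bracket,
    ← Real.sqrt_inv, inv_div, one_div, ← Real.sqrt_inv]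
  congr 3
  field_simp
  ring

lemma two_le_bracket {a : ℝ} (ha0 : 0 < a) (ha1 : a < 1) : 2 ≤ bracket a := by
  have h1 : 0 < 1 - a := by linarith
  rw [bracket_eq_integral ha0 ha1]
  have : ∫ _z in (-1 : ℝ)..1, (1 : ℝ) = 2 := by norm_num
  rw [← this]
  refine intervalIntegral.integral_mono_on (by norm_num) (by simp)
    ((by fun_prop : Continuous _).intervalIntegrable _ _) fun z _ => ?_
  rw [Real.one_le_sqrt]
  have : 0 ≤ a / (1 - a) * z ^ 2 := by positivity
  linarith

lemma one_div_sqrt_le_bracket {a : ℝ} : 1 / Real.sqrt (1 - a) ≤ bracket a := by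
  rw [bracket]
  have : 0 ≤ Real.arsinh (Real.sqrt (a / (1 - a))) :=
    Real.arsinh_nonneg_iff.mpr (Real.sqrt_nonneg _)
  have : 0 ≤ Real.sqrt ((1 - a) / a) * Real.arsinh (Real.sqrt (a / (1 - a))) := by positivity
  linarith

lemma integral_sphere_sqrt {a : ℝ} (ha0 : 0 < a) (ha1 : a < 1) {e : E3} (he : ‖e‖ = 1) (s : ℝ) :
    ∫ x : Metric.sphere (0 : E3) 1,
        s * Real.sqrt (1 + a / (1 - a) * (inner ℝ e (x : E3)) ^ 2)
          ∂(volume : Measure E3).toSphere = 2 * Real.pi * (s * bracket a) := by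
  rw [integral_const_mul,
    integral_sphere_inner he (g := fun z => Real.sqrt (1 + a / (1 - a) * z ^ 2)) (by fun_prop),
    bracket_eq_integral ha0 ha1]
  ring

/-- On the unit sphere `yᵀ T² y = s² (1 + a y_z² / (1-a))`, a function of one coordinate. Only
squares enter, so the signs of the entries are free. -/
lemma borderIntegral_diagonal {a : ℝ} (ha0 : 0 < a) (ha1 : a < 1) {x z s : ℝ} (hs : 0 ≤ s)
    (hx : x ^ 2 = s ^ 2) (hz : z ^ 2 = s ^ 2 / (1 - a)) :
    borderIntegral (Matrix.diagonal ![x, x, z]) = s * bracket a := by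
  have h1 : 0 < 1 - a := by linarith
  have key : ∀ y : Metric.sphere (0 : E3) 1,
      Real.sqrt ((y : E3).ofLp ⬝ᵥ ((Matrix.diagonal ![x, x, z] ^ 2) *ᵥ (y : E3).ofLp)) =
        s * Real.sqrt (1 + a / (1 - a) * (inner ℝ ez (y : E3)) ^ 2) := by
    intro y
    have hn := norm_sq_eq_sum (y : E3)
    rw [norm_eq_of_mem_sphere y] at hn
    have he : inner ℝ ez (y : E3) = (y : E3) 2 := by simp [inner_eq_sum, ez]
    have hss : s * Real.sqrt (1 + a / (1 - a) * (y : E3) 2 ^ 2) =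
        Real.sqrt (s ^ 2 * (1 + a / (1 - a) * (y : E3) 2 ^ 2)) := by
      rw [Real.sqrt_mul (sq_nonneg _), Real.sqrt_sq hs]
    rw [he, hss]
    congr 1
    rw [Matrix.diagonal_pow]
    simp [dotProduct, Matrix.mulVec_diagonal, Fin.sum_univ_three]
    rw [hx, hz]
    have h0 : (y : E3) 0 ^ 2 + (y : E3) 1 ^ 2 = 1 - (y : E3) 2 ^ 2 := by linarith
    have h2 : (y : E3) 0 * (s ^ 2 * (y : E3) 0) + (y : E3) 1 * (s ^ 2 * (y : E3) 1) =
      s ^ 2 * (1 - (y : E3) 2 ^ 2) := by rw [← h0]; ring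
    rw [h2]
    field_simp
    ring
  rw [borderIntegral]
  simp only [key]
  rw [integral_sphere_sqrt ha0 ha1 (by simp [ez])]
  have := Real.pi_ne_zero
  field_simp

/-! ### Integrals of odd and of reflected functions over the ball -/

lemma integral_ball_comp_isometry (ρ : E3 ≃ₗᵢ[ℝ] E3) (f : E3 → ℝ) :
    ∫ x in Metric.ball (0 : E3) 1, f (ρ x) = ∫ x in Metric.ball (0 : E3) 1, f x := by
  rw [← ρ.measurePreserving.setIntegral_preimage_emb ρ.toHomeomorph.measurableEmbedding f]
  congr 2
  ext x
  simp

lemma integral_ball_of_odd {f : E3 → ℝ} (hf : ∀ x, f (-x) = -f x) :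
    ∫ x in Metric.ball (0 : E3) 1, f x = 0 := by
  have h := integral_ball_comp_isometry (LinearIsometryEquiv.neg ℝ) f
  simp only [LinearIsometryEquiv.coe_neg, hf, integral_neg] at h
  linarith

lemma measurable_sign : Measurable (fun r : ℝ => (SignType.sign r : ℝ)) := by
  have : (fun r : ℝ => (SignType.sign r : ℝ)) =
      fun r => if 0 < r then 1 else if r < 0 then -1 else 0 := by
    ext r
    rw [sign_apply]
    split_ifs <;> simp
  rw [this]
  exact Measurable.ite measurableSet_Ioi measurable_const
    (Measurable.ite measurableSet_Iio measurable_const measurable_const)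

lemma abs_sign_le_one (r : ℝ) : |(SignType.sign r : ℝ)| ≤ 1 := by
  rcases lt_trichotomy r 0 with h | h | h <;> simp [h]

lemma sign_coe_neg (r : ℝ) : (SignType.sign (-r) : ℝ) = -(SignType.sign r : ℝ) := by
  rw [Left.sign_neg]
  simp

lemma integrableOn_ball_of_continuous {f : E3 → ℝ} (hf : Continuous f) :
    IntegrableOn f (Metric.ball (0 : E3) 1) :=
  (hf.continuousOn.integrableOn_compact (isCompact_closedBall 0 1)).mono_set
    Metric.ball_subset_closedBall

lemma integrableOn_ball_sign_mul (q : E3) {f : E3 → ℝ} (hf : Continuous f) :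
    IntegrableOn (fun x => (SignType.sign (inner ℝ q x : ℝ) : ℝ) * f x)
      (Metric.ball (0 : E3) 1) := by
  refine Integrable.bdd_mul (c := 1) (integrableOn_ball_of_continuous hf) ?_ ?_
  · exact (measurable_sign.comp (by fun_prop)).aestronglyMeasurable
  · exact Filter.Eventually.of_forall fun x => abs_sign_le_one _

/-- The first moment of the difference of two opposite half-balls. -/
lemma integral_ball_sign_inner (q y : E3) :
    ‖q‖ * ∫ x in Metric.ball (0 : E3) 1, (SignType.sign (inner ℝ q x : ℝ) : ℝ) * inner ℝ x y =
      Real.pi / 2 * inner ℝ q y := by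
  rcases eq_or_ne q 0 with rfl | hq
  · simp
  have hq' : 0 < ‖q‖ := norm_pos_iff.mpr hq
  obtain ⟨e, he, hqe⟩ : ∃ e : E3, ‖e‖ = 1 ∧ q = ‖q‖ • e :=
    ⟨‖q‖⁻¹ • q, norm_smul_inv_norm (𝕜 := ℝ) hq, (smul_inv_smul₀ hq'.ne' q).symm⟩
  have hsign : ∀ x, SignType.sign (inner ℝ q x : ℝ) = SignType.sign (inner ℝ e x : ℝ) := by
    intro x
    rw [hqe, inner_smul_left, sign_mul]
    simp [hq']
  simp only [hsign]
  -- The reflection fixes `e` and negates its complement. Averaging the integrand over it removes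
  -- the transverse part and leaves `|⟨e, x⟩| ⟨e, y⟩`.
  set ρ : E3 ≃ₗᵢ[ℝ] E3 := Submodule.reflection (ℝ ∙ e) with hρ
  have hρe : ρ e = e := Submodule.reflection_mem_subspace_eq_self
    (Submodule.mem_span_singleton_self e)
  have hρx : ∀ x, inner ℝ e (ρ x) = (inner ℝ e x : ℝ) := by
    intro x
    conv_lhs => rw [← hρe]
    exact ρ.inner_map_map e x
  have hρy : ∀ x, x + ρ x = (2 * inner ℝ e x : ℝ) • e := by
    intro x
    rw [hρ, Submodule.reflection_singleton_apply, he]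
    simp [two_smul, mul_smul]
  have hsymm : ∀ x, inner ℝ (ρ x) y = (inner ℝ x (ρ y) : ℝ) := by
    intro x
    have := ρ.inner_map_map x (ρ y)
    rwa [hρ, Submodule.reflection_reflection] at this
  set F : E3 → ℝ := fun x => (SignType.sign (inner ℝ e x : ℝ) : ℝ) * inner ℝ x y with hF
  have hFi : IntegrableOn F (Metric.ball (0 : E3) 1) :=
    integrableOn_ball_sign_mul e (by fun_prop)
  have hFρ : (fun x => F (ρ x)) =
      fun x => (SignType.sign (inner ℝ e x : ℝ) : ℝ) * inner ℝ x (ρ y) := by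
    ext x
    simp only [hF, hρx, hsymm]
  have hFρi : IntegrableOn (fun x => F (ρ x)) (Metric.ball (0 : E3) 1) := by
    rw [hFρ]
    exact integrableOn_ball_sign_mul e (by fun_prop)
  have habs : ∫ x in Metric.ball (0 : E3) 1, |(inner ℝ e x : ℝ)| = Real.pi / 2 := by
    rw [integral_ball_inner he (h := fun z => |z|) (by fun_prop)]
    have hi : ∀ a b : ℝ, IntervalIntegrable (fun z : ℝ => |z| * (1 - z ^ 2)) volume a b :=
      fun a b => (by fun_prop : Continuous _).intervalIntegrable _ _
    have h1 : ∫ z in (0 : ℝ)..1, |z| * (1 - z ^ 2) = 1 / 4 := by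
      have : ∀ z ∈ Set.uIcc (0 : ℝ) 1, |z| * (1 - z ^ 2) = z ^ 1 - z ^ 3 := by
        intro z hz
        rw [Set.uIcc_of_le zero_le_one] at hz
        rw [abs_of_nonneg hz.1]
        ring
      rw [intervalIntegral.integral_congr this, intervalIntegral.integral_sub (by simp) (by simp),
        integral_pow, integral_pow]
      norm_num
    have h2 : ∫ z in (-1 : ℝ)..0, |z| * (1 - z ^ 2) = 1 / 4 := by
      rw [← h1]
      have := intervalIntegral.integral_comp_neg (a := 0) (b := 1)
        (fun z : ℝ => |z| * (1 - z ^ 2))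
      simpa using this.symm
    rw [← intervalIntegral.integral_add_adjacent_intervals (hi (-1) 0) (hi 0 1), h1, h2]
    ring
  have hsum : (∫ x in Metric.ball (0 : E3) 1, F x) + ∫ x in Metric.ball (0 : E3) 1, F (ρ x) =
      2 * inner ℝ e y * (Real.pi / 2) := by
    rw [← integral_add hFi hFρi, ← habs, ← integral_const_mul]
    refine integral_congr_ae (Filter.Eventually.of_forall fun x => ?_)
    have := congrFun hFρ x
    simp only at this ⊢
    rw [this, hF]
    simp only
    rw [← mul_add, ← inner_add_right, hρy, inner_smul_right, real_inner_comm e x,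
      ← sign_mul_self (inner ℝ e x : ℝ)]
    ring
  rw [integral_ball_comp_isometry] at hsum
  have hqy : (inner ℝ q y : ℝ) = ‖q‖ * inner ℝ e y := by
    conv_lhs => rw [hqe]
    rw [inner_smul_left]
    simp
  rw [hqy]
  linear_combination ‖q‖ / 2 * hsum

/-! ### Local hidden state models -/

lemma integral_mul_blochOp {Λ : Type} [MeasurableSpace Λ] {μ : Measure Λ} {p : Λ → ℝ} {g : Λ → E3}
    (hp : Integrable p μ) (hpg : ∀ i, Integrable (fun l => p l * g l i) μ) (j k : Fin 2) :
    ∫ l, (p l : ℂ) * blochOp 1 (g l) j k ∂μ =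
      blochOp (∫ l, p l ∂μ) (WithLp.toLp 2 fun i => ∫ l, p l * g l i ∂μ) j k := by
  have hc : ∀ i, Integrable (fun l => ((p l * g l i : ℝ) : ℂ)) μ := fun i => (hpg i).ofReal
  have hpc : Integrable (fun l => (p l : ℂ)) μ := hp.ofReal
  have h0 : ∫ l, (p l : ℂ) ∂μ = ((∫ l, p l ∂μ : ℝ) : ℂ) := integral_ofReal
  have hi : ∀ i, ∫ l, ((p l * g l i : ℝ) : ℂ) ∂μ = ((∫ l, p l * g l i ∂μ : ℝ) : ℂ) :=
    fun i => integral_ofReal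
  fin_cases j <;> fin_cases k <;> simp only [blochOp, Fin.zero_eta, Fin.mk_one, Fin.isValue,
    Matrix.of_apply, Matrix.cons_val', Matrix.cons_val_zero, Matrix.cons_val_one,
    Matrix.cons_val_fin_one]
  · rw [← h0, ← hi, ← integral_add hpc (hc 2), ← integral_div]
    congr 1; ext l; push_cast; ring
  · rw [← hi, ← hi, ← integral_mul_const, ← integral_sub (hc 0) ((hc 1).mul_const _),
      ← integral_div]
    congr 1; ext l; push_cast; ring
  · rw [← hi, ← hi, ← integral_mul_const, ← integral_add (hc 0) ((hc 1).mul_const _),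
      ← integral_div]
    congr 1; ext l; push_cast; ring
  · rw [← h0, ← hi, ← integral_sub hpc (hc 2), ← integral_div]
    congr 1; ext l; push_cast; ring

/-- A local hidden state model in terms of Bloch vectors: the hidden states have the Bloch vectors
`g`, and `R m` is the expectation of Alice's `±1`-valued answer when she measures along `m`. -/
lemma nonSteerable_of_bloch_model {Λ : Type} [MeasurableSpace Λ] (μ : Measure Λ)
    [IsProbabilityMeasure μ] {w : E3} {ξ : ℝ} {g : Λ → E3} (hg : Measurable g)
    (hg1 : ∀ l, ‖g l‖ ≤ 1) {R : E3 → Λ → ℝ} (hR : ∀ m, Measurable (R m))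
    (hR0 : ∀ l, R 0 l = 0) (hRneg : ∀ m l, R (-m) l = -R m l)
    (hR1 : ∀ m, ‖m‖ = 1 → ∀ l, |R m l| ≤ 1)
    (hRint : ∀ m, ‖m‖ = 1 → ∫ l, R m l ∂μ = inner ℝ w m)
    (hgint : ∀ i, ∫ l, g l i ∂μ = 0)
    (hRg : ∀ m, ‖m‖ = 1 → ∀ i, ∫ l, R m l * g l i ∂μ = -(ξ * m i)) :
    NonSteerable (displacedWerner w ξ) := by
  have hgm : ∀ i, Measurable fun l => g l i := fun i => by fun_prop
  have hgi : ∀ i l, ‖g l i‖ ≤ 1 := fun i l => (PiLp.norm_apply_le (g l) i).trans (hg1 l)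
  refine ⟨Λ, inferInstance, μ, fun l => blochOp 1 (g l), inferInstance, fun j k => ?_,
    fun l => isState_blochOp (hg1 l), fun n P hP => ?_⟩
  · have h0 := hgm 0
    have h1 := hgm 1
    have h2 := hgm 2
    fin_cases j <;> fin_cases k <;> simp [blochOp] <;> fun_prop
  obtain ⟨t, m, hPtm, hcl, ht, e, c, hc, hme⟩ := hP.exists_bloch
  have hRe : ∀ i l, R (m i) l = c i * R e l := by
    intro i l
    obtain ⟨h1, h2 | h2 | h2⟩ := hme i <;> rw [h1, h2] <;> simp [hR0, hRneg]
  have hbd : ∀ i l, |R (m i) l| ≤ 1 := by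
    intro i l
    rcases hcl i with ⟨h, -⟩ | ⟨-, h⟩
    · simp [h, hR0]
    · exact hR1 _ h l
  have hRI : ∀ i, Integrable (R (m i)) μ := fun i =>
    Integrable.of_bound (hR _).aestronglyMeasurable 1 (Filter.Eventually.of_forall (hbd i))
  have hgI : ∀ i, Integrable (fun l => g l i) μ := fun i =>
    Integrable.of_bound (hgm i).aestronglyMeasurable 1 (Filter.Eventually.of_forall (hgi i))
  have hRgI : ∀ i j, Integrable (fun l => R (m i) l * g l j) μ := fun i j =>
    (hgI j).bdd_mul (c := 1) (hR _).aestronglyMeasurable (Filter.Eventually.of_forall (hbd i))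
  -- Trivial outcomes get probability `0` or `1` because `R 0 = 0`; oddness of `R` and `∑ c i = 0`
  -- make the probabilities sum to `1`.
  refine ⟨fun i l => (t i + R (m i) l) / 2, fun i => ?_, fun i l => ?_, fun l => ?_,
    fun i j k => ?_⟩
  · have := hR (m i)
    fun_prop
  · rcases hcl i with ⟨h, h'⟩ | ⟨h', h⟩
    · simp only [h, hR0]
      rcases h' with h' | h' <;> rw [h'] <;> norm_num
    · have := (abs_le.mp (hbd i l)).1
      simp only [h']
      linarith
  · rw [← Finset.sum_div, Finset.sum_add_distrib, ht]
    simp only [hRe]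
    rw [← Finset.sum_mul, hc]
    norm_num
  · have e1 : ∀ j l, (t i + R (m i) l) / 2 * g l j =
        t i / 2 * g l j + 1 / 2 * (R (m i) l * g l j) := fun j l => by ring
    have i1 : ∀ j, Integrable (fun l => t i / 2 * g l j) μ := fun j => (hgI j).const_mul _
    have i2 : ∀ j, Integrable (fun l => 1 / 2 * (R (m i) l * g l j)) μ :=
      fun j => (hRgI i j).const_mul _
    rw [hPtm i, conditionalState_displacedWerner, integral_mul_blochOp]
    · have a1 : ∫ l, (t i + R (m i) l) / 2 ∂μ = (t i + inner ℝ w (m i)) / 2 := by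
        rw [integral_div, integral_add (integrable_const _) (hRI i)]
        rcases hcl i with ⟨h, -⟩ | ⟨-, h⟩
        · simp [h, hR0]
        · simp [hRint _ h]
      have a2 : ∀ j, ∫ l, (t i + R (m i) l) / 2 * g l j ∂μ = -(ξ * m i j) / 2 := by
        intro j
        simp only [e1]
        rw [integral_add (i1 j) (i2 j), integral_const_mul, integral_const_mul, hgint]
        rcases hcl i with ⟨h, -⟩ | ⟨-, h⟩
        · simp [h, hR0]
        · rw [hRg _ h]
          ring
      simp only [a1, a2]
      fin_cases j <;> fin_cases k <;> simp [blochOp] <;> ring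
    · exact ((integrable_const _).add (hRI i)).div_const 2
    · intro j
      simp only [e1]
      exact (i1 j).add (i2 j)

/-! ### The ellipsoid model for positive `ξ` -/

/-- The probability measure on the unit ball with density proportional to `‖T x‖`. -/
def ellipsoidMeasure (T : E3 →L[ℝ] E3) (N : ℝ) : Measure E3 :=
  (volume.restrict (Metric.ball 0 1)).withDensity fun x => ENNReal.ofReal (N⁻¹ * ‖T x‖)

lemma integral_ellipsoidMeasure (T : E3 →L[ℝ] E3) {N : ℝ} (hN : 0 < N) (f : E3 → ℝ) :
    ∫ x, f x ∂ellipsoidMeasure T N = N⁻¹ * ∫ x in Metric.ball 0 1, ‖T x‖ * f x := by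
  rw [ellipsoidMeasure, integral_withDensity_eq_integral_toReal_smul (by fun_prop)
    (Filter.Eventually.of_forall fun x => ENNReal.ofReal_lt_top), ← integral_const_mul]
  refine integral_congr_ae (Filter.Eventually.of_forall fun x => ?_)
  simp only [smul_eq_mul]
  rw [ENNReal.toReal_ofReal (by positivity)]
  ring

lemma isProbabilityMeasure_ellipsoidMeasure (T : E3 →L[ℝ] E3) {N : ℝ} (hN : 0 < N)
    (h : ∫ x in Metric.ball 0 1, ‖T x‖ = N) : IsProbabilityMeasure (ellipsoidMeasure T N) := by
  constructor
  rw [ellipsoidMeasure, withDensity_apply _ MeasurableSet.univ, Measure.restrict_univ,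
    ← ofReal_integral_eq_lintegral_ofReal, integral_const_mul, h, inv_mul_cancel₀ hN.ne',
    ENNReal.ofReal_one]
  · exact integrableOn_ball_of_continuous (by fun_prop)
  · exact Filter.Eventually.of_forall fun x => by positivity

/-- The local hidden state model in which the hidden Bloch vectors are distributed over an
ellipsoid. -/
lemma nonSteerable_of_ellipsoid {w : E3} {ξ N : ℝ} (T : E3 →L[ℝ] E3) (Q : E3 →ₗ[ℝ] E3)
    (hN : 0 < N) (hTN : ∫ x in Metric.ball 0 1, ‖T x‖ = N) (hTQ : ∀ m, T (Q m) = ξ • m)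
    (hb : ∀ m, ‖m‖ = 1 → |inner ℝ w m| + 2 * N / Real.pi * ‖Q m‖ ≤ 1) :
    NonSteerable (displacedWerner w ξ) := by
  have := isProbabilityMeasure_ellipsoidMeasure T hN hTN
  have hpi := Real.pi_pos
  -- The density cancels the normalisation. Where `T x = 0` the hidden Bloch vector is `0`, by `0⁻¹
  -- = 0`, and the density vanishes as well.
  have hTg : ∀ x i, ‖T x‖ * (-(‖T x‖⁻¹ • T x)) i = -(T x i) := by
    intro x i
    rcases eq_or_ne (T x) 0 with h | h
    · simp [h]
    · have : ‖T x‖ ≠ 0 := norm_ne_zero_iff.mpr h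
      simp [this]
  have hadj : ∀ x i, T x i = inner ℝ x (T.adjoint (EuclideanSpace.single i 1)) := by
    intro x i
    rw [ContinuousLinearMap.adjoint_inner_right, EuclideanSpace.inner_single_right]
    simp
  have hsign : ∀ m, Measurable fun x : E3 => (SignType.sign (inner ℝ (Q m) x : ℝ) : ℝ) :=
    fun m => measurable_sign.comp (by fun_prop)
  -- The factor `2N/π` offsets the normalisation `1/N` and the half-ball moment `π/2`, so the mean
  -- of `R m` times the Bloch vector is `-T (Q m)`. The term `⟨w, m⟩` gives Alice's marginal and
  -- drops out of the correlations by parity.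
  refine nonSteerable_of_bloch_model (ellipsoidMeasure T N)
    (g := fun x => -(‖T x‖⁻¹ • T x))
    (R := fun m x => inner ℝ w m + 2 * N / Real.pi * ‖Q m‖ *
      (SignType.sign (inner ℝ (Q m) x : ℝ) : ℝ))
    (by fun_prop) (fun x => ?_) (fun m => ?_) (fun x => by simp) (fun m x => ?_)
    (fun m hm x => ?_) (fun m _ => ?_) (fun i => ?_) (fun m _ i => ?_)
  · rw [norm_neg, norm_smul, norm_inv, norm_norm]
    exact inv_mul_le_one
  · exact ((hsign m).const_mul _).const_add _
  · simp only [map_neg, inner_neg_right, inner_neg_left, sign_coe_neg, norm_neg]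
    ring
  · refine (abs_add_le _ _).trans (le_trans ?_ (hb m hm))
    rw [abs_mul, abs_of_nonneg (by positivity : 0 ≤ 2 * N / Real.pi * ‖Q m‖)]
    have := mul_le_mul_of_nonneg_left (abs_sign_le_one (inner ℝ (Q m) x))
      (by positivity : 0 ≤ 2 * N / Real.pi * ‖Q m‖)
    linarith
  · rw [integral_ellipsoidMeasure T hN]
    have e1 : ∀ x, ‖T x‖ * (inner ℝ w m + 2 * N / Real.pi * ‖Q m‖ *
        (SignType.sign (inner ℝ (Q m) x : ℝ) : ℝ)) = inner ℝ w m * ‖T x‖ +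
        2 * N / Real.pi * ‖Q m‖ * ((SignType.sign (inner ℝ (Q m) x : ℝ) : ℝ) * ‖T x‖) :=
      fun x => by ring
    simp only [e1]
    rw [integral_add ((integrableOn_ball_of_continuous (by fun_prop)).const_mul _)
      ((integrableOn_ball_sign_mul _ (by fun_prop)).const_mul _), integral_const_mul,
      integral_const_mul, hTN, integral_ball_of_odd (f := fun x =>
        (SignType.sign (inner ℝ (Q m) x : ℝ) : ℝ) * ‖T x‖)]
    · field_simp
      ring
    · intro x
      rw [inner_neg_right, sign_coe_neg, map_neg, norm_neg, neg_mul]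
  · rw [integral_ellipsoidMeasure T hN]
    simp only [hTg]
    rw [integral_ball_of_odd (by simp), mul_zero]
  · rw [integral_ellipsoidMeasure T hN]
    have e1 : ∀ x, ‖T x‖ * ((inner ℝ w m + 2 * N / Real.pi * ‖Q m‖ *
        (SignType.sign (inner ℝ (Q m) x : ℝ) : ℝ)) * (-(‖T x‖⁻¹ • T x)) i) =
        -inner ℝ w m * T x i + -(2 * N / Real.pi) * (‖Q m‖ *
          ((SignType.sign (inner ℝ (Q m) x : ℝ) : ℝ) * T x i)) := by
      intro x
      linear_combination (inner ℝ w m + 2 * N / Real.pi * ‖Q m‖ *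
        (SignType.sign (inner ℝ (Q m) x : ℝ) : ℝ)) * hTg x i
    simp only [e1]
    rw [integral_add ((integrableOn_ball_of_continuous (by fun_prop)).const_mul _)
      (((integrableOn_ball_sign_mul _ (by fun_prop)).const_mul _).const_mul _),
      integral_const_mul, integral_const_mul, integral_const_mul,
      integral_ball_of_odd (f := fun x => T x i) (by simp)]
    simp only [hadj]
    rw [integral_ball_sign_inner, ← hadj, hTQ]
    simp
    field_simp

/-- The model applies to displaced Werner operators below the border. -/
lemma nonSteerable_displacedWerner_of_pos {a : ℝ} (ha0 : 0 < a) (ha1 : a < 1) {w : E3} {ξ : ℝ}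
    (hw : ‖w‖ = a) (hξ0 : 0 < ξ) (hξ : ξ ≤ Real.sqrt (1 - a) * (bracket a)⁻¹) :
    NonSteerable (displacedWerner w ξ) := by
  have h1 : 0 < 1 - a := by linarith
  obtain ⟨c, hc0, hc⟩ : ∃ c : ℝ, 0 < c ∧ c ^ 2 = 1 - a :=
    ⟨Real.sqrt (1 - a), Real.sqrt_pos.mpr h1, Real.sq_sqrt h1.le⟩
  have hcs : Real.sqrt (1 - a) = c := by rw [← hc, Real.sqrt_sq hc0.le]
  have hB := two_le_bracket ha0 ha1
  have hB0 : 0 < bracket a := by linarith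
  obtain ⟨e, he, hwe⟩ : ∃ e : E3, ‖e‖ = 1 ∧ w = a • e := by
    have hw0 : w ≠ 0 := norm_pos_iff.mp (hw ▸ ha0)
    refine ⟨‖w‖⁻¹ • w, norm_smul_inv_norm (𝕜 := ℝ) hw0, ?_⟩
    rw [← hw, smul_inv_smul₀ (norm_ne_zero_iff.mpr hw0)]
  have hee : inner ℝ e e = (1 : ℝ) := by rw [real_inner_self_eq_norm_sq, he]; norm_num
  have hs0 : 0 < ξ / c := by positivity
  -- Up to sign and rotation, `T` is the correlation matrix of the `T`-state preimage, and `Q` is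
  -- the contraction by the damping channel.
  set T : E3 →L[ℝ] E3 := (ξ / c) • ContinuousLinearMap.id ℝ E3 +
    (ξ / c ^ 2 - ξ / c) • (innerSL ℝ e).smulRight e with hT
  set Q : E3 →ₗ[ℝ] E3 := c • LinearMap.id + (c ^ 2 - c) • (innerₛₗ ℝ e).smulRight e with hQ
  have hTx : ∀ x, T x = (ξ / c) • x + (ξ / c ^ 2 - ξ / c) • (inner ℝ e x : ℝ) • e := by
    intro x; simp [hT]
  have hQx : ∀ x, Q x = c • x + (c ^ 2 - c) • (inner ℝ e x : ℝ) • e := by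
    intro x; simp [hQ]
  have hnorm : ∀ (α β : ℝ) (x : E3), ‖α • x + β • (inner ℝ e x : ℝ) • e‖ ^ 2 =
      α ^ 2 * ‖x‖ ^ 2 + (2 * α * β + β ^ 2) * inner ℝ e x ^ 2 := by
    intro α β x
    rw [norm_add_sq_real, norm_smul, norm_smul, norm_smul, he, inner_smul_left, inner_smul_right,
      inner_smul_right, real_inner_comm x e]
    simp only [mul_pow, Real.norm_eq_abs, sq_abs, conj_trivial]
    rw [real_inner_comm]
    ring
  have hTn : ∀ x : Metric.sphere (0 : E3) 1,
      ‖T x‖ = ξ / c * Real.sqrt (1 + a / (1 - a) * (inner ℝ e (x : E3)) ^ 2) := by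
    intro x
    rw [← sq_eq_sq₀ (norm_nonneg _) (by positivity), hTx, hnorm, mul_pow,
      Real.sq_sqrt (by positivity), norm_eq_of_mem_sphere x, ← hc]
    have : a = 1 - c ^ 2 := by linarith
    rw [this]
    field_simp
    ring
  have hTN : ∫ x in Metric.ball 0 1, ‖T x‖ = Real.pi / 2 * (ξ / c * bracket a) := by
    rw [integral_ball_homogeneous 1 (f := fun x => ‖T x‖)]
    · simp only [hTn]
      rw [integral_sphere_sqrt ha0 ha1 he]
      push_cast
      ring
    · intro r x hr
      rw [map_smul, norm_smul, Real.norm_eq_abs, abs_of_pos hr, pow_one]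
  have hpi := Real.pi_pos
  refine nonSteerable_of_ellipsoid T Q (by positivity) hTN (fun m => ?_) (fun m hm => ?_)
  · rw [hTx, hQx, inner_add_right, inner_smul_right, inner_smul_right, inner_smul_right, hee]
    ext i
    simp
    field_simp
    ring
  · have hI : 2 * (Real.pi / 2 * (ξ / c * bracket a)) / Real.pi ≤ 1 := by
      have : 2 * (Real.pi / 2 * (ξ / c * bracket a)) / Real.pi = ξ * bracket a / c := by
        field_simp
      rw [this, div_le_one hc0]
      rw [hcs, ← div_eq_mul_inv, le_div_iff₀ hB0] at hξ
      exact hξ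
    refine le_trans (add_le_add_right (mul_le_mul_of_nonneg_right hI (norm_nonneg _)) _) ?_
    rw [one_mul]
    have hem : |inner ℝ e m| ≤ (1 : ℝ) := by
      have := abs_real_inner_le_norm e m
      rwa [he, hm, one_mul] at this
    have hwm : |inner ℝ w m| = a * |inner ℝ e m| := by
      rw [hwe, inner_smul_left, abs_mul]
      simp [abs_of_pos ha0]
    -- With `t = |⟨e, m⟩|` the right side minus the left is exactly `a (1-t)²`.
    have hQn : ‖Q m‖ ^ 2 ≤ (1 - a * |inner ℝ e m|) ^ 2 := by
      rw [hQx, hnorm, hm, ← sq_abs (inner ℝ e m : ℝ)]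
      have h4 : c ^ 4 = (1 - a) ^ 2 := by rw [← hc]; ring
      nlinarith [mul_nonneg ha0.le (sq_nonneg (1 - |(inner ℝ e m : ℝ)|))]
    have := abs_le_of_sq_le_sq hQn (by nlinarith [abs_nonneg (inner ℝ e m : ℝ)])
    rw [abs_of_nonneg (norm_nonneg _)] at this
    linarith

/-! ### The separable case -/

/-- The singlet `ψ` and `(w·σ ⊗ I) ψ` span an invariant plane; the bound is positivity of the
quadratic form on it. -/
lemma IsState.displacedWerner_bound {a : ℝ} (ha : 0 < a) {w : E3} {ξ : ℝ} (hw : ‖w‖ = a)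
    (h : IsState (displacedWerner w ξ)) :
    0 < 1 + 3 * ξ ∧ a ^ 2 ≤ (1 + 3 * ξ) * (1 - ξ) := by
  have hform : ∀ α β : ℝ, 0 ≤ (1 + 3 * ξ) * α ^ 2 + 2 * a ^ 2 * (α * β)
      + (1 - ξ) * a ^ 2 * β ^ 2 := by
    intro α β
    -- The test vector is `α ψ + β (w·σ ⊗ I) ψ` with `ψ = |01⟩ - |10⟩`.
    have hv := h.1.dotProduct_mulVec_nonneg fun r : Fin 2 × Fin 2 =>
      (!![-(β * (w 0 - w 1 * Complex.I)), (α + β * w 2 : ℂ);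
        -(α - β * w 2 : ℂ), β * (w 0 + w 1 * Complex.I)] : Op) r.1 r.2
    rw [Complex.le_def] at hv
    have h1 := hv.1
    simp [displacedWerner, blochState, pauli, Fin.sum_univ_succ, Matrix.one_apply, dotProduct,
      Matrix.mulVec, Fintype.sum_prod_type] at h1
    have hn := norm_sq_eq_sum w
    rw [hw] at hn
    rw [hn]
    linarith
  have h0 : 0 ≤ 1 + 3 * ξ := by simpa using hform 1 0
  have ha2 : 0 < a ^ 2 := by positivity
  have hpos : 0 < 1 + 3 * ξ := by
    rcases h0.eq_or_lt with h0 | h0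
    · exfalso
      have := hform (-1) 1
      rw [← h0] at this
      have hξ : ξ = -1 / 3 := by linarith
      rw [hξ] at this
      nlinarith
    · exact h0
  refine ⟨hpos, ?_⟩
  -- The ratio `α/β = -a²/(1+3ξ)` minimises the form, so this is the discriminant condition.
  have := hform (a ^ 2) (-(1 + 3 * ξ))
  have h2 : 0 ≤ ((1 + 3 * ξ) * a ^ 2) * ((1 + 3 * ξ) * (1 - ξ) - a ^ 2) := by
    linarith
  linarith [nonneg_of_mul_nonneg_right h2 (by positivity)]

/-- A discrete probability measure given by its weights. -/
def weightedMeasure {Λ : Type} [MeasurableSpace Λ] [Fintype Λ] (W : Λ → ℝ) : Measure Λ :=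
  ∑ l, ENNReal.ofReal (W l) • Measure.dirac l

lemma isProbabilityMeasure_weightedMeasure {Λ : Type} [MeasurableSpace Λ] [Fintype Λ] {W : Λ → ℝ}
    (hW : ∀ l, 0 ≤ W l) (h : ∑ l, W l = 1) : IsProbabilityMeasure (weightedMeasure W) := by
  constructor
  simp only [weightedMeasure, Measure.coe_finsetSum, Finset.sum_apply, Measure.smul_apply,
    measure_univ, smul_eq_mul, mul_one]
  rw [← ENNReal.ofReal_sum_of_nonneg fun l _ => hW l, h, ENNReal.ofReal_one]

lemma integral_weightedMeasure {Λ : Type} [MeasurableSpace Λ] [MeasurableSingletonClass Λ]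
    [Fintype Λ] {W : Λ → ℝ} (hW : ∀ l, 0 ≤ W l) (f : Λ → ℝ) :
    ∫ l, f l ∂weightedMeasure W = ∑ l, W l * f l := by
  rw [weightedMeasure, integral_finsetSum_measure]
  · refine Finset.sum_congr rfl fun l _ => ?_
    rw [integral_smul_measure, integral_dirac, ENNReal.toReal_ofReal (hW l), smul_eq_mul]
  · intro l _
    exact (integrable_dirac (by simp)).smul_measure ENNReal.ofReal_ne_top

/-- For `ξ ≤ 0` a displaced Werner state is a mixture of six product states. -/
lemma nonSteerable_displacedWerner_of_nonpos {a : ℝ} (ha0 : 0 < a) {w : E3} {ξ : ℝ}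
    (hw : ‖w‖ = a) (hξ : ξ ≤ 0) (h : IsState (displacedWerner w ξ)) :
    NonSteerable (displacedWerner w ξ) := by
  obtain ⟨hpos, hbound⟩ := h.displacedWerner_bound ha0 hw
  obtain ⟨η, rfl⟩ : ∃ η, ξ = -η := ⟨-ξ, by ring⟩
  have hη0 : 0 ≤ η := by linarith
  have hη1 : 0 < 1 - η := by linarith
  obtain ⟨e, he, hwe⟩ : ∃ e : E3, ‖e‖ = 1 ∧ w = a • e := by
    have hw0 : w ≠ 0 := norm_pos_iff.mp (hw ▸ ha0)
    refine ⟨‖w‖⁻¹ • w, norm_smul_inv_norm (𝕜 := ℝ) hw0, ?_⟩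
    rw [← hw, smul_inv_smul₀ (norm_ne_zero_iff.mpr hw0)]
  obtain ⟨b, hb⟩ := exists_orthonormalBasis_apply_zero he
  set ε : Bool → ℝ := fun s => if s then 1 else -1 with hε
  have hεt : ε true = 1 := by simp [hε]
  have hεf : ε false = -1 := by simp [hε]
  have hε1 : ∀ s, ε s ^ 2 = 1 := by intro s; cases s <;> simp [hε]
  -- Bob holds `±b k`, so each axis must carry correlation `η`. On the axis of `w` Alice's pure
  -- states `±b 0` need total weight only `η`; the other axes share the rest and carry the
  -- displacement `a`.
  set W : Fin 3 × Bool → ℝ := fun l => ![η / 2, (1 - η) / 4, (1 - η) / 4] l.1 with hW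
  set α : Fin 3 × Bool → E3 := fun l => (![0, a / (1 - η), a / (1 - η)] l.1 : ℝ) • b 0
    + (ε l.2 * ![1, 2 * η / (1 - η), 2 * η / (1 - η)] l.1) • b l.1 with hα
  have hW0 : ∀ l, 0 ≤ W l := by
    rintro ⟨k, s⟩
    fin_cases k <;> simp [hW] <;> linarith
  have hW1 : ∑ l, W l = 1 := by
    simp [hW, Fintype.sum_prod_type, Fin.sum_univ_three]
    ring
  have hα1 : ∀ l, ‖α l‖ ≤ 1 := by
    have hq : ∀ (k : Fin 3) (s : Bool), k ≠ 0 →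
        ‖(a / (1 - η)) • b 0 + (ε s * (2 * η / (1 - η))) • b k‖ ≤ 1 := by
      intro k s hk
      rw [← sq_le_one_iff₀ (norm_nonneg _), norm_add_sq_real, norm_smul, norm_smul,
        inner_smul_left, inner_smul_right, b.orthonormal.2 hk.symm]
      simp only [OrthonormalBasis.norm_eq_one, mul_one, mul_zero, add_zero, Real.norm_eq_abs,
        sq_abs, mul_pow, hε1, one_mul, div_pow]
      rw [← add_div, div_le_one (by positivity)]
      -- The claim `a² + 4η² ≤ (1-η)²` is the state bound, as `(1-3η)(1+η) = (1-η)² - 4η²`.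
      nlinarith
    rintro ⟨k, s⟩
    fin_cases k
    · simp only [hα]
      cases s <;> simp [hε]
    · exact hq 1 s (by decide)
    · exact hq 2 s (by decide)
  have hprob := isProbabilityMeasure_weightedMeasure hW0 hW1
  refine nonSteerable_of_bloch_model (weightedMeasure W)
    (g := fun l => ε l.2 • b l.1) (R := fun m l => inner ℝ m (α l))
    (measurable_of_finite _) (fun l => ?_) (fun m => measurable_of_finite _) (fun l => by simp)
    (fun m l => by simp) (fun m hm l => ?_) (fun m _ => ?_) (fun i => ?_) (fun m _ i => ?_)
  · rw [norm_smul, b.norm_eq_one, mul_one, Real.norm_eq_abs, ← sq_le_one_iff_abs_le_one, hε1]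
  · refine (abs_real_inner_le_norm _ _).trans ?_
    rw [hm, one_mul]
    exact hα1 l
  · rw [integral_weightedMeasure hW0, hwe, ← hb]
    simp only [hW, hα, Fintype.sum_prod_type, Fin.sum_univ_three, Fintype.sum_bool, hεt, hεf,
      inner_add_right, inner_smul_right, inner_smul_left, real_inner_comm m (b 0)]
    simp
    field_simp
    ring
  · rw [integral_weightedMeasure hW0]
    simp [hW, Fintype.sum_prod_type, hεt, hεf]
  · rw [integral_weightedMeasure hW0]
    have hm := congrArg (fun v : E3 => v i) (b.sum_repr' m)
    simp only [Fin.sum_univ_three, PiLp.add_apply, PiLp.smul_apply, smul_eq_mul] at hm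
    rw [← hm]
    simp only [hW, hα, Fintype.sum_prod_type, Fin.sum_univ_three, Fintype.sum_bool, hεt, hεf,
      inner_add_right, inner_smul_right, real_inner_comm m]
    simp
    field_simp
    ring

/-! ### The main theorem -/

lemma nonSteerable_displacedWerner {a : ℝ} (ha0 : 0 < a) (ha1 : a < 1) {w : E3} {ξ : ℝ}
    (hw : ‖w‖ = a) (h : IsState (displacedWerner w ξ))
    (hξ : ξ ≤ Real.sqrt (1 - a) * (bracket a)⁻¹) : NonSteerable (displacedWerner w ξ) := by
  rcases le_or_gt ξ 0 with h0 | h0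
  · exact nonSteerable_displacedWerner_of_nonpos ha0 hw h0 h
  · exact nonSteerable_displacedWerner_of_pos ha0 ha1 hw h0 hξ

lemma exists_tState_preimage {a : ℝ} (ha0 : 0 < a) (ha1 : a < 1) {u : ℝ}
    (hu : Real.sin u * Real.sin u = a) {ξ : ℝ} (hξ0 : 0 ≤ ξ)
    (hξ : ξ ≤ Real.sqrt (1 - a) * (bracket a)⁻¹) :
    ∃ t : Fin 3 → ℝ, IsState (tState t) ∧ borderIntegral (Matrix.diagonal t) ≤ 1 ∧
      (borderIntegral (Matrix.diagonal t) = 1 ↔ ξ = Real.sqrt (1 - a) * (bracket a)⁻¹) ∧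
      applyA (extremalChannel u u) (tState t) = displacedWerner (a • ez) ξ := by
  have h1 : 0 < 1 - a := by linarith
  have hc2 : Real.cos u ^ 2 = 1 - a := by rw [Real.cos_sq', ← hu]; ring
  have hc0 : Real.cos u ≠ 0 := by
    intro h
    rw [h] at hc2
    norm_num at hc2
    linarith
  have hB := two_le_bracket ha0 ha1
  have hB0 : 0 < bracket a := by linarith
  have hB1 := one_div_sqrt_le_bracket (a := a)
  obtain ⟨c, hc, hcp⟩ : ∃ c, c = Real.sqrt (1 - a) ∧ 0 < c := ⟨_, rfl, Real.sqrt_pos.mpr h1⟩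
  have hcsq : c ^ 2 = 1 - a := by rw [hc, Real.sq_sqrt h1.le]
  rw [← hc] at hξ hB1 ⊢
  have hcabs : |Real.cos u| = c := by
    rw [hc, ← hc2, Real.sqrt_sq_eq_abs]
  have hbi : borderIntegral
      (Matrix.diagonal ![-ξ / Real.cos u, -ξ / Real.cos u, -ξ / Real.cos u ^ 2]) =
      ξ / c * bracket a := by
    refine borderIntegral_diagonal ha0 ha1 (by positivity) ?_ ?_
    · rw [div_pow, div_pow, hc2, hcsq, neg_sq]
    · rw [hc2, div_pow, div_pow, hcsq, neg_sq]
      field_simp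
  have hle : ξ / c * bracket a ≤ 1 := by
    rw [← div_eq_mul_inv, le_div_iff₀ hB0] at hξ
    rw [div_mul_eq_mul_div, div_le_one hcp]
    exact hξ
  have hs0 : 0 ≤ ξ / c := by positivity
  -- Given `ξ B / c ≤ 1`, the bound `1/c ≤ B` yields `|z| ≤ 1`, and `2 ≤ B` yields `2|x| ≤ 1 ≤ 1 -
  -- z`, since `z ≤ 0`.
  refine ⟨![-ξ / Real.cos u, -ξ / Real.cos u, -ξ / Real.cos u ^ 2], isState_tState ?_ ?_, ?_, ?_,
    applyA_tState hu hc0⟩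
  · rw [hc2, ← hcsq, abs_div, abs_neg, abs_of_nonneg hξ0, abs_of_pos (by positivity)]
    have := (mul_le_mul_of_nonneg_left hB1 hs0).trans hle
    calc ξ / c ^ 2 = ξ / c * (1 / c) := by field_simp
      _ ≤ 1 := this
  · rw [abs_div, abs_neg, abs_of_nonneg hξ0, hcabs, hc2, neg_div]
    have := (mul_le_mul_of_nonneg_left hB hs0).trans hle
    have h3 : 0 ≤ ξ / (1 - a) := by positivity
    linarith
  · rw [hbi]
    exact hle
  · rw [hbi, div_mul_eq_mul_div, div_eq_one_iff_eq hcp.ne', ← div_eq_mul_inv, eq_div_iff hB0.ne']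

end QubitSteering

end

theorem mainTheorem2 (a : ℝ) (ha0 : 0 < a) (ha1 : a < 1) :
    (∀ (w : QubitSteering.E3) (ξ : ℝ), ‖w‖ = a →
      QubitSteering.IsState (QubitSteering.displacedWerner w ξ) →
      ξ ≤ (1 - a) * (QubitSteering.bracket a)⁻¹ →
      QubitSteering.NonSteerable (QubitSteering.displacedWerner w ξ)) ∧
    (∀ (w : QubitSteering.E3) (ξ : ℝ), ‖w‖ = a →
      QubitSteering.IsState (QubitSteering.displacedWerner w ξ) →
      ξ ≤ Real.sqrt (1 - a) * (QubitSteering.bracket a)⁻¹ →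
      QubitSteering.NonSteerable (QubitSteering.displacedWerner w ξ)) ∧
    (∀ u : ℝ, Real.sin u * Real.sin u = a →
      QubitSteering.extremalChannel u u ∈
        Set.extremePoints ℝ {Φ | QubitSteering.IsCPTP Φ} ∧
      ∀ ξ : ℝ, 0 ≤ ξ → ξ ≤ Real.sqrt (1 - a) * (QubitSteering.bracket a)⁻¹ →
        ∃ t : Fin 3 → ℝ,
          QubitSteering.IsState (QubitSteering.tState t) ∧
          QubitSteering.borderIntegral (Matrix.diagonal t) ≤ 1 ∧
          (QubitSteering.borderIntegral (Matrix.diagonal t) = 1 ↔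
            ξ = Real.sqrt (1 - a) * (QubitSteering.bracket a)⁻¹) ∧
          QubitSteering.applyA (QubitSteering.extremalChannel u u) (QubitSteering.tState t) =
            QubitSteering.displacedWerner (a • QubitSteering.ez) ξ) := by
  refine ⟨fun w ξ hw hst hξ => ?_,
    fun w ξ hw hst hξ => QubitSteering.nonSteerable_displacedWerner ha0 ha1 hw hst hξ,
    fun u hu => ⟨QubitSteering.extremalChannel_mem_extremePoints u,
      fun ξ hξ0 hξ => QubitSteering.exists_tState_preimage ha0 ha1 hu hξ0 hξ⟩⟩
  refine QubitSteering.nonSteerable_displacedWerner ha0 ha1 hw hst (hξ.trans ?_)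
  have hB := QubitSteering.two_le_bracket ha0 ha1
  refine mul_le_mul_of_nonneg_right ?_ (inv_nonneg.mpr (by linarith))
  -- For `0 < a < 1`, `(1-a)² ≤ 1-a`, so the first threshold lies below the second.
  exact Real.le_sqrt_of_sq_le (by nlinarith)
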